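/- Let $d\ge 1$, $\delta>0$, $1\le p,q<\infty$ and $\alpha\in\mathbb R$ with $\alpha>-d/p$. Let the Herz space $K^{\alpha,q}_p=K^{\alpha,q}_p(\mathbb R^d)$ consist of all (classes of almost everywhere equal) locally $p$-integrable functions $f:\mathbb R^d\to\mathbb C$ with $$\|f\|_{K^{\alpha,q}_p}:=\|f\chi_{|\cdot|\le 1}\|_p+\Big(\sum_{l=1}^\infty 2^{l\alpha q}\,\|f\chi_{2^{l-1}<|\cdot|\le 2^l}\|_p^q\Big)^{1/q}<\infty .$$ For a Schwartz function $f$ let the Bochner-Riesz mean $B_\delta f$ be defined by $\widehat{B_\delta f}(\xi)=(1-|\xi|^2)_+^\delta\,\hat f(\xi)$, where $\hat f(\xi)=\int_{\mathbb R^d} f(x)e^{-ix\cdot\xi}\,dx$ and $t_+=\max(t,0)$. Theorem. Suppose that $B_\delta$ is bounded on $K^{\alpha,q}_p$, that is, there is a constant $C$ such that $\|B_\delta f\|_{K^{\alpha,q}_p}\le C\|f\|_{K^{\alpha,q}_p}$ for all Schwartz functions $f$. Then $B_\delta$ has a unique extension from the Schwartz functions to a bounded linear operator on $K^{\alpha,q}_p$,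 and the spectrum of this extension, that is, the set of all $z\in\mathbb C$ for which $zI-B_\delta$ does not have a bounded inverse on $K^{\alpha,q}_p$, is the unit interval $[0,1]$. -/

import Mathlib

open MeasureTheory
open scoped ENNReal NNReal SchwartzMap

noncomputable section

/-! ## Bochner-Riesz means on Schwartz functions -/

/-- The Fourier transform `∫ f(x) e^{-i x·ξ} dx`. -/
def fourierHat {d : ℕ} (f : EuclideanSpace ℝ (Fin d) → ℂ) (ξ : EuclideanSpace ℝ (Fin d)) : ℂ :=
  ∫ x : EuclideanSpace ℝ (Fin d), f x * Complex.exp (-(Complex.I * ((inner ℝ x ξ : ℝ) : ℂ)))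

/-- The inverse Fourier transform `(2π)^{-d} ∫ g(ξ) e^{i x·ξ} dξ`. -/
def fourierCheck {d : ℕ} (g : EuclideanSpace ℝ (Fin d) → ℂ) (x : EuclideanSpace ℝ (Fin d)) : ℂ :=
  ((((2 * Real.pi) ^ d)⁻¹ : ℝ) : ℂ) *
    ∫ ξ : EuclideanSpace ℝ (Fin d), g ξ * Complex.exp (Complex.I * ((inner ℝ x ξ : ℝ) : ℂ))

/-- The Bochner-Riesz symbol `(1 - |ξ|²)_+^δ`. -/
def bochnerRieszSymbol {d : ℕ} (δ : ℝ) (ξ : EuclideanSpace ℝ (Fin d)) : ℝ :=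
  (max (1 - ‖ξ‖ ^ 2) 0) ^ δ

/-- The Bochner-Riesz mean `B_δ f` of a Schwartz function `f`. -/
def bochnerRiesz {d : ℕ} (δ : ℝ) (f : 𝓢(EuclideanSpace ℝ (Fin d), ℂ)) :
    EuclideanSpace ℝ (Fin d) → ℂ :=
  fourierCheck fun ξ => (bochnerRieszSymbol δ ξ : ℂ) * fourierHat (fun x => f x) ξ

/-! ## Herz spaces -/

/-- The dyadic annulus `2^{l-1} < |x| ≤ 2^l`, used for `l ≥ 1`. -/
def dyadicAnnulus (d : ℕ) (l : ℕ) : Set (EuclideanSpace ℝ (Fin d)) :=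
  {x | (2 : ℝ) ^ ((l : ℝ) - 1) < ‖x‖ ∧ ‖x‖ ≤ (2 : ℝ) ^ (l : ℝ)}

/-- The Herz norm
`‖f χ_{|x| ≤ 1}‖_p + (∑_{l ≥ 1} 2^{lαq} ‖f χ_{2^{l-1} < |x| ≤ 2^l}‖_p^q)^{1/q}`,
with values in `[0, ∞]`. The sum over `l ≥ 1` is written as a sum over `k = l - 1 ≥ 0`. -/
def herzENorm {d : ℕ} (α p q : ℝ) (f : EuclideanSpace ℝ (Fin d) → ℂ) : ℝ≥0∞ :=
  eLpNorm ({x | ‖x‖ ≤ 1}.indicator f) (ENNReal.ofReal p) volume +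
    (∑' k : ℕ, ENNReal.ofReal ((2 : ℝ) ^ (((k + 1 : ℕ) : ℝ) * α * q)) *
      eLpNorm ((dyadicAnnulus d (k + 1)).indicator f) (ENNReal.ofReal p) volume ^ q) ^ (1 / q)

theorem measurableSet_dyadicAnnulus (d l : ℕ) : MeasurableSet (dyadicAnnulus d l) :=
  (measurableSet_lt measurable_const measurable_norm).inter
    (measurableSet_le measurable_norm measurable_const)

theorem measurableSet_normLeOne (d : ℕ) :
    MeasurableSet {x : EuclideanSpace ℝ (Fin d) | ‖x‖ ≤ 1} :=
  measurableSet_le measurable_norm measurable_const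

theorem herzENorm_congr_ae {d : ℕ} {α p q : ℝ} {f g : EuclideanSpace ℝ (Fin d) → ℂ}
    (h : f =ᵐ[volume] g) : herzENorm α p q f = herzENorm α p q g := by
  have key : ∀ s : Set (EuclideanSpace ℝ (Fin d)),
      eLpNorm (s.indicator f) (ENNReal.ofReal p) volume =
        eLpNorm (s.indicator g) (ENNReal.ofReal p) volume := fun s =>
    eLpNorm_congr_ae (h.mono fun x hx => by
      by_cases hs : x ∈ s <;> simp [hs, hx])
  simp only [herzENorm, key]

theorem herzENorm_zero {d : ℕ} {α p q : ℝ} (hq : 1 ≤ q) :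
    herzENorm α p q (0 : EuclideanSpace ℝ (Fin d) → ℂ) = 0 := by
  have h0 : 0 < q := by linarith
  simp [herzENorm, h0]

theorem herzENorm_const_smul {d : ℕ} {α p q : ℝ} (hq : 1 ≤ q) (c : ℂ)
    (f : EuclideanSpace ℝ (Fin d) → ℂ) :
    herzENorm α p q (c • f) = ‖c‖ₑ * herzENorm α p q f := by
  have h0 : 0 < q := by linarith
  have key : ∀ s : Set (EuclideanSpace ℝ (Fin d)),
      eLpNorm (s.indicator (c • f)) (ENNReal.ofReal p) volume =
        ‖c‖ₑ * eLpNorm (s.indicator f) (ENNReal.ofReal p) volume := fun s => by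
    have hs : s.indicator (c • f) = c • s.indicator f := Set.indicator_const_smul s c f
    rw [hs]
    exact eLpNorm_const_smul c _ _ _
  simp only [herzENorm, key, ENNReal.mul_rpow_of_nonneg _ _ h0.le]
  simp only [mul_left_comm _ (‖c‖ₑ ^ q), ENNReal.tsum_mul_left]
  rw [ENNReal.mul_rpow_of_nonneg _ _ (by positivity), ← ENNReal.rpow_mul,
    mul_one_div_cancel h0.ne', ENNReal.rpow_one, mul_add]

theorem tsum_rpow_add_le {q : ℝ} (hq : 1 ≤ q) (a b : ℕ → ℝ≥0∞) :
    (∑' k, (a k + b k) ^ q) ^ (1 / q) ≤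
      (∑' k, a k ^ q) ^ (1 / q) + (∑' k, b k ^ q) ^ (1 / q) := by
  have h := ENNReal.lintegral_Lp_add_le (μ := (Measure.count : Measure ℕ)) (f := a) (g := b)
    (measurable_of_countable a).aemeasurable (measurable_of_countable b).aemeasurable hq
  simpa only [lintegral_count, Pi.add_apply] using h

theorem herzENorm_add_le {d : ℕ} {α p q : ℝ} (hp : 1 ≤ p) (hq : 1 ≤ q)
    {f g : EuclideanSpace ℝ (Fin d) → ℂ}
    (hf : AEStronglyMeasurable f volume) (hg : AEStronglyMeasurable g volume) :
    herzENorm α p q (f + g) ≤ herzENorm α p q f + herzENorm α p q g := by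
  have h0 : 0 < q := by linarith
  have hp' : 1 ≤ ENNReal.ofReal p := by simpa using hp
  have key : ∀ s : Set (EuclideanSpace ℝ (Fin d)), MeasurableSet s →
      eLpNorm (s.indicator (f + g)) (ENNReal.ofReal p) volume ≤
        eLpNorm (s.indicator f) (ENNReal.ofReal p) volume +
        eLpNorm (s.indicator g) (ENNReal.ofReal p) volume := fun s hs => by
    rw [Set.indicator_add']
    exact eLpNorm_add_le (hf.indicator hs) (hg.indicator hs) hp'
  have hw : ∀ (k : ℕ) (a : ℝ≥0∞),
      ENNReal.ofReal ((2 : ℝ) ^ (((k + 1 : ℕ) : ℝ) * α * q)) * a ^ q =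
        (ENNReal.ofReal ((2 : ℝ) ^ (((k + 1 : ℕ) : ℝ) * α)) * a) ^ q := fun k a => by
    rw [ENNReal.mul_rpow_of_nonneg _ _ h0.le, ENNReal.ofReal_rpow_of_nonneg (by positivity) h0.le,
      ← Real.rpow_mul (by norm_num)]
  unfold herzENorm
  simp only [hw]
  refine le_trans (add_le_add (key _ (measurableSet_normLeOne d)) ?_) (add_add_add_comm _ _ _ _).le
  refine le_trans ?_ (tsum_rpow_add_le hq _ _)
  refine ENNReal.rpow_le_rpow (ENNReal.tsum_le_tsum fun k => ?_) (by positivity)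
  refine ENNReal.rpow_le_rpow ?_ h0.le
  rw [← mul_add]
  exact mul_le_mul_right (key _ (measurableSet_dyadicAnnulus d _)) _

theorem exists_mem_dyadicAnnulus {d : ℕ} {x : EuclideanSpace ℝ (Fin d)} (hx : 1 < ‖x‖) :
    ∃ k : ℕ, x ∈ dyadicAnnulus d (k + 1) := by
  have hex : ∃ n : ℕ, ‖x‖ ≤ (2 : ℝ) ^ n :=
    (pow_unbounded_of_one_lt ‖x‖ (one_lt_two)).imp fun _ h => h.le
  classical
  have hspec := Nat.find_spec hex
  have hne : Nat.find hex ≠ 0 := by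
    intro h
    rw [h] at hspec
    simp at hspec
    linarith
  obtain ⟨k, hk⟩ := Nat.exists_eq_succ_of_ne_zero hne
  refine ⟨k, ?_, ?_⟩
  · have := Nat.find_min hex (m := k) (by omega)
    simpa using this
  · rw [hk] at hspec
    rw [Real.rpow_natCast]
    exact hspec

theorem ae_eq_zero_of_herzENorm_eq_zero {d : ℕ} {α p q : ℝ} (hp : 1 ≤ p) (hq : 1 ≤ q)
    {f : EuclideanSpace ℝ (Fin d) → ℂ} (hf : AEStronglyMeasurable f volume)
    (h : herzENorm α p q f = 0) : f =ᵐ[volume] 0 := by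
  have h0 : 0 < q := by linarith
  have hp' : ENNReal.ofReal p ≠ 0 := by simpa using by linarith
  obtain ⟨h1, h2⟩ := add_eq_zero.mp h
  rw [eLpNorm_eq_zero_iff (hf.indicator (measurableSet_normLeOne d)) hp'] at h1
  rw [ENNReal.rpow_eq_zero_iff_of_pos (by positivity), ENNReal.tsum_eq_zero] at h2
  have h3 : ∀ k : ℕ, (dyadicAnnulus d (k + 1)).indicator f =ᵐ[volume] 0 := fun k => by
    rw [← eLpNorm_eq_zero_iff (hf.indicator (measurableSet_dyadicAnnulus d _)) hp']
    rcases mul_eq_zero.mp (h2 k) with h4 | h4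
    · exact absurd h4 (by simpa using by positivity)
    · exact (ENNReal.rpow_eq_zero_iff_of_pos h0).mp h4
  filter_upwards [h1, ae_all_iff.mpr h3] with x hx1 hx2
  by_cases hx : ‖x‖ ≤ 1
  · simpa [hx] using hx1
  · obtain ⟨k, hk⟩ := exists_mem_dyadicAnnulus (lt_of_not_ge hx)
    simpa [hk] using hx2 k

/-- The classes (modulo null sets) of measurable functions with finite Herz norm; such functions
are locally `p`-integrable. -/
def herzSubmodule (d : ℕ) (α p q : ℝ) [hp : Fact (1 ≤ p)] [hq : Fact (1 ≤ q)] :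
    Submodule ℂ (EuclideanSpace ℝ (Fin d) →ₘ[volume] ℂ) where
  carrier := {f | herzENorm α p q f < ∞}
  zero_mem' := by
    show herzENorm α p q _ < ∞
    rw [herzENorm_congr_ae AEEqFun.coeFn_zero, herzENorm_zero hq.out]
    exact ENNReal.zero_lt_top
  add_mem' := fun {f g} hf hg => by
    show herzENorm α p q _ < ∞
    rw [herzENorm_congr_ae (AEEqFun.coeFn_add f g)]
    exact (herzENorm_add_le hp.out hq.out f.aestronglyMeasurable g.aestronglyMeasurable).trans_lt
      (ENNReal.add_lt_top.mpr ⟨hf, hg⟩)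
  smul_mem' := fun c f hf => by
    show herzENorm α p q _ < ∞
    rw [herzENorm_congr_ae (AEEqFun.coeFn_smul c f), herzENorm_const_smul hq.out]
    exact ENNReal.mul_lt_top enorm_lt_top hf

/-- The Herz space `K_p^{α,q}(ℝ^d)`. -/
def HerzSpace (d : ℕ) (α p q : ℝ) [Fact (1 ≤ p)] [Fact (1 ≤ q)] : Type :=
  ↥(herzSubmodule d α p q)

namespace HerzSpace

variable {d : ℕ} {α p q : ℝ} [hp : Fact (1 ≤ p)] [hq : Fact (1 ≤ q)]

instance : AddCommGroup (HerzSpace d α p q) :=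
  inferInstanceAs (AddCommGroup ↥(herzSubmodule d α p q))

instance : Module ℂ (HerzSpace d α p q) :=
  inferInstanceAs (Module ℂ ↥(herzSubmodule d α p q))

/-- A representative of an element of the Herz space. -/
instance : CoeFun (HerzSpace d α p q) (fun _ => EuclideanSpace ℝ (Fin d) → ℂ) :=
  ⟨fun f => (f.1 : EuclideanSpace ℝ (Fin d) →ₘ[volume] ℂ)⟩

instance : Norm (HerzSpace d α p q) := ⟨fun f => (herzENorm α p q f).toReal⟩

theorem normCore : NormedSpace.Core ℂ (HerzSpace d α p q) where
  norm_nonneg _ := ENNReal.toReal_nonneg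
  norm_smul c f := by
    show (herzENorm α p q _).toReal = _ * (herzENorm α p q _).toReal
    have h : herzENorm α p q (c • f : HerzSpace d α p q) = ‖c‖ₑ * herzENorm α p q f :=
      (herzENorm_congr_ae (AEEqFun.coeFn_smul c f.1)).trans (herzENorm_const_smul hq.out c _)
    rw [h, ENNReal.toReal_mul, toReal_enorm]
  norm_triangle f g := by
    show (herzENorm α p q _).toReal ≤ (herzENorm α p q _).toReal + (herzENorm α p q _).toReal
    have h : herzENorm α p q (f + g : HerzSpace d α p q) ≤
        herzENorm α p q f + herzENorm α p q g :=
      (herzENorm_congr_ae (AEEqFun.coeFn_add f.1 g.1)).le.trans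
        (herzENorm_add_le hp.out hq.out f.1.aestronglyMeasurable g.1.aestronglyMeasurable)
    have hf : herzENorm α p q f ≠ ∞ := ne_of_lt f.2
    have hg : herzENorm α p q g ≠ ∞ := ne_of_lt g.2
    rw [← ENNReal.toReal_add hf hg]
    exact ENNReal.toReal_mono (ENNReal.add_ne_top.mpr ⟨hf, hg⟩) h
  norm_eq_zero_iff f := by
    constructor
    · intro h
      have h' : herzENorm α p q f = 0 :=
        ((ENNReal.toReal_eq_zero_iff _).mp h).resolve_right (ne_of_lt f.2)
      have h1 := ae_eq_zero_of_herzENorm_eq_zero hp.out hq.out f.1.aestronglyMeasurable h'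
      exact Subtype.ext (AEEqFun.ext (h1.trans AEEqFun.coeFn_zero.symm))
    · rintro rfl
      show (herzENorm α p q _).toReal = 0
      have h : herzENorm α p q (0 : HerzSpace d α p q) = 0 :=
        (herzENorm_congr_ae AEEqFun.coeFn_zero).trans (herzENorm_zero hq.out)
      rw [h, ENNReal.toReal_zero]

instance : NormedAddCommGroup (HerzSpace d α p q) := NormedAddCommGroup.ofCore normCore

instance : NormedSpace ℂ (HerzSpace d α p q) := NormedSpace.ofCore normCore

end HerzSpace

/-- `B_δ` is bounded on `K_p^{α,q}`: it satisfies a norm inequality on the (dense) subspace of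
Schwartz functions. In particular `B_δ f` has finite Herz norm for every Schwartz `f`. -/
def BochnerRieszBoundedOnHerz (d : ℕ) (δ α p q : ℝ) : Prop :=
  ∃ C : ℝ≥0, ∀ f : 𝓢(EuclideanSpace ℝ (Fin d), ℂ),
    herzENorm α p q (bochnerRiesz δ f) ≤ C * herzENorm α p q (fun x => f x)

/-- The bounded operator `T` on `K_p^{α,q}` extends `B_δ` from the Schwartz functions. -/
def ExtendsBochnerRiesz {d : ℕ} {α p q : ℝ} [Fact (1 ≤ p)] [Fact (1 ≤ q)] (δ : ℝ)
    (T : HerzSpace d α p q →L[ℂ] HerzSpace d α p q) : Prop :=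
  ∀ (f : 𝓢(EuclideanSpace ℝ (Fin d), ℂ)) (F : HerzSpace d α p q),
    F =ᵐ[volume] (fun x => f x) → T F =ᵐ[volume] bochnerRiesz δ f

end

open Filter Topology FourierTransform

local notation "𝔼" d:max => EuclideanSpace ℝ (Fin d)

/-! ## The sequence norm -/

/-! Write m(ξ) = (1 - |ξ|²)_+^δ. For small δ, neither m nor m/(z - m) need have an integrable
kernel, so the resolvent cannot be estimated directly. A high power repairs this: m^n = (1 -
|ξ|²)_+^{δn} is C^J once δn > J, and for z outside [0,1] so is m^n (z - m)^{-1}, because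
differentiation keeps one within the family t_+^β (z - t_+^δ)^{-j} while lowering β by at most 1
(`contDiffOn_powerProfile`). These symbols have compact support, so their kernels decay like (1 +
|x|)^{-J} (`exists_fourierInv_decay`). Convolution with such a kernel is bounded on the Herz space
whenever α > -d/p (`exists_herzLNorm_convolution_le`): Young's inequality handles neighbouring
shells, and between distant shells the kernel is dominated by a product of functions of x and of y.

Upper bound for the spectrum. Let S be the bounded operator with symbol m^n (z - m)^{-1}. Then (z -
T) S = T^n, hence (z - T)(∑_{i<n} z^i T^{n-1-i} + S) = z^n, and z ≠ 0 because 0 lies in [0,1]. So z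
- T is invertible.

Lower bound. A plane wave is an eigenfunction of convolution with the kernel of m^n. Cutting it off
at scale 2^N gives an error smaller by a factor 2^{-N} than the norm of the packet, so every value
of m^n is an approximate eigenvalue of T^n (`symbol_mem_spectrum`). These values fill [0,1].
Spectral mapping for powers gives μ in the spectrum of T with μ^n = t^n, and the upper bound forces
μ ≥ 0, so μ = t.

Identities between symbols become identities between operators through L²: Schwartz functions are
dense in the Herz space, and an element lying also in L² is approximated in both norms at once
(`exists_schwartz_approx`). Hence the extension agrees with the L² multiplier on common elements
(`exists_multiplier_extension`), and an operator agreeing with a given L² operator is unique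
(`Agrees.unique`). -/

/-- The `ℓ^q` norm of a sequence in `[0, ∞]`. -/
noncomputable def seqNorm (q : ℝ) (c : ℕ → ℝ≥0∞) : ℝ≥0∞ := (∑' n, c n ^ q) ^ (1 / q)

theorem seqNorm_mono {q : ℝ} (hq : 1 ≤ q) {a b : ℕ → ℝ≥0∞} (h : ∀ n, a n ≤ b n) :
    seqNorm q a ≤ seqNorm q b := by
  unfold seqNorm
  gcongr with n
  exact h n

theorem seqNorm_add_le {q : ℝ} (hq : 1 ≤ q) (a b : ℕ → ℝ≥0∞) :
    seqNorm q (fun n => a n + b n) ≤ seqNorm q a + seqNorm q b :=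
  tsum_rpow_add_le hq a b

theorem seqNorm_const_mul {q : ℝ} (hq : 1 ≤ q) (c : ℝ≥0∞) (a : ℕ → ℝ≥0∞) :
    seqNorm q (fun n => c * a n) = c * seqNorm q a := by
  have h0 : 0 < q := by linarith
  simp only [seqNorm, ENNReal.mul_rpow_of_nonneg _ _ h0.le, ENNReal.tsum_mul_left]
  rw [ENNReal.mul_rpow_of_nonneg _ _ (by positivity), ← ENNReal.rpow_mul,
    mul_one_div_cancel h0.ne', ENNReal.rpow_one]

theorem le_seqNorm {q : ℝ} (hq : 1 ≤ q) (a : ℕ → ℝ≥0∞) (n : ℕ) : a n ≤ seqNorm q a := by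
  have h0 : 0 < q := by linarith
  calc a n = (a n ^ q) ^ (1 / q) := by
        rw [← ENNReal.rpow_mul, mul_one_div_cancel h0.ne', ENNReal.rpow_one]
    _ ≤ _ := by
        unfold seqNorm
        gcongr
        exact ENNReal.le_tsum n

/-- Since a_n^q ≤ a_n (∑ a)^{q-1}, summing gives ∑ a_n^q ≤ (∑ a)^q. This suffices for the
geometrically decaying sequences below. -/
theorem seqNorm_le_tsum {q : ℝ} (hq : 1 ≤ q) (a : ℕ → ℝ≥0∞) : seqNorm q a ≤ ∑' n, a n := by
  have h0 : 0 < q := by linarith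
  have hsplit : ∀ c : ℝ≥0∞, c ^ q = c * c ^ (q - 1) := fun c => by
    conv_rhs => rw [← ENNReal.rpow_one c, ← ENNReal.rpow_mul, one_mul]
    rw [← ENNReal.rpow_add_of_nonneg _ _ zero_le_one (by linarith)]
    congr 1
    ring
  have h : ∑' n, a n ^ q ≤ (∑' n, a n) ^ q := by
    rw [hsplit (∑' n, a n), ← ENNReal.tsum_mul_right]
    refine ENNReal.tsum_le_tsum fun n => ?_
    rw [hsplit]
    gcongr
    exact ENNReal.le_tsum n
  calc seqNorm q a ≤ ((∑' n, a n) ^ q) ^ (1 / q) := by unfold seqNorm; gcongr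
    _ = _ := by rw [← ENNReal.rpow_mul, mul_one_div_cancel h0.ne', ENNReal.rpow_one]

theorem seqNorm_comp_succ_le {q : ℝ} (hq : 1 ≤ q) (a : ℕ → ℝ≥0∞) :
    seqNorm q (fun n => a (n + 1)) ≤ seqNorm q a := by
  refine ENNReal.rpow_le_rpow ?_ (by positivity)
  exact ENNReal.tsum_comp_le_tsum_of_injective (add_left_injective 1) fun n => a n ^ q

/-- From x^q + y^q ≤ (x + y)^q for q ≥ 1. It allows the unit ball to be treated as one more shell.
-/
theorem seqNorm_le_zero_add_succ {q : ℝ} (hq : 1 ≤ q) (a : ℕ → ℝ≥0∞) :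
    seqNorm q a ≤ a 0 + seqNorm q (fun n => a (n + 1)) := by
  have h0 : 0 < q := by linarith
  have h := ENNReal.rpow_add_rpow_le_add (a 0) (seqNorm q fun n => a (n + 1)) hq
  have h2 : seqNorm q (fun n => a (n + 1)) ^ q = ∑' n, a (n + 1) ^ q := by
    rw [seqNorm, ← ENNReal.rpow_mul, one_div_mul_cancel h0.ne', ENNReal.rpow_one]
  rw [h2, ← tsum_eq_zero_add' (f := fun n => a n ^ q) ENNReal.summable] at h
  exact h

/-- Truncated subtraction makes the entry at 0 occur twice; this accounts for the factor 2. -/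
theorem seqNorm_comp_pred_le {q : ℝ} (hq : 1 ≤ q) (a : ℕ → ℝ≥0∞) :
    seqNorm q (fun n => a (n - 1)) ≤ 2 * seqNorm q a := by
  refine (seqNorm_le_zero_add_succ hq _).trans ?_
  rw [two_mul]
  exact add_le_add (le_seqNorm hq a 0) le_rfl

/-! ## Dyadic shells -/

/-- The dyadic shells: the unit ball for `n = 0`, and the dyadic annulus for `n ≥ 1`. -/
def herzShell (d n : ℕ) : Set (𝔼 d) :=
  if n = 0 then {x | ‖x‖ ≤ 1} else dyadicAnnulus d n

theorem herzShell_zero (d : ℕ) : herzShell d 0 = {x | ‖x‖ ≤ 1} := rfl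

theorem herzShell_succ (d n : ℕ) : herzShell d (n + 1) = dyadicAnnulus d (n + 1) := rfl

theorem mem_herzShell_succ {d n : ℕ} {x : 𝔼 d} :
    x ∈ herzShell d (n + 1) ↔ (2 : ℝ) ^ n < ‖x‖ ∧ ‖x‖ ≤ 2 ^ (n + 1) := by
  have h : ((n + 1 : ℕ) : ℝ) - 1 = n := by push_cast; ring
  rw [herzShell_succ, dyadicAnnulus, Set.mem_ofPred_eq, h, Real.rpow_natCast, Real.rpow_natCast]

theorem measurableSet_herzShell (d n : ℕ) : MeasurableSet (herzShell d n) := by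
  cases n with
  | zero => exact measurableSet_normLeOne d
  | succ n => exact measurableSet_dyadicAnnulus d _

theorem norm_le_of_mem_herzShell {d n : ℕ} {x : 𝔼 d} (hx : x ∈ herzShell d n) :
    ‖x‖ ≤ 2 ^ n := by
  cases n with
  | zero => simpa [herzShell_zero] using hx
  | succ n => exact (mem_herzShell_succ.mp hx).2

theorem exists_mem_herzShell {d : ℕ} (x : 𝔼 d) : ∃ n, x ∈ herzShell d n := by
  by_cases hx : ‖x‖ ≤ 1
  · exact ⟨0, hx⟩
  · obtain ⟨k, hk⟩ := exists_mem_dyadicAnnulus (lt_of_not_ge hx)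
    exact ⟨k + 1, hk⟩

theorem lt_norm_of_mem_herzShell {d n m : ℕ} {x : 𝔼 d} (hx : x ∈ herzShell d n) (h : m < n) :
    (2 : ℝ) ^ m < ‖x‖ := by
  obtain ⟨k, rfl⟩ := Nat.exists_eq_add_of_lt h
  refine lt_of_le_of_lt ?_ (mem_herzShell_succ.mp hx).1
  gcongr <;> grind

theorem disjoint_herzShell (d : ℕ) : Pairwise (Function.onFun Disjoint (herzShell d)) := by
  have key : ∀ m n, m < n → Disjoint (herzShell d m) (herzShell d n) := fun m n h => by
    rw [Set.disjoint_left]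
    intro x hm hn
    exact absurd (norm_le_of_mem_herzShell hm) (not_le.mpr (lt_norm_of_mem_herzShell hn h))
  intro m n h
  rcases lt_or_gt_of_ne h with h | h
  · exact key m n h
  · exact (key n m h).symm

theorem iUnion_herzShell (d : ℕ) : ⋃ n, herzShell d n = Set.univ :=
  Set.eq_univ_of_forall fun x => Set.mem_iUnion.mpr (exists_mem_herzShell x)

theorem lintegral_eq_tsum_herzShell {d : ℕ} (f : 𝔼 d → ℝ≥0∞) :
    ∫⁻ x, f x = ∑' n, ∫⁻ x in herzShell d n, f x := by
  rw [← lintegral_iUnion (measurableSet_herzShell d) (disjoint_herzShell d), iUnion_herzShell,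
    Measure.restrict_univ]

theorem half_two_pow_le {n : ℕ} {d : ℕ} {x : 𝔼 d} (hx : x ∈ herzShell d n) :
    (2 : ℝ) ^ n ≤ 2 * (1 + ‖x‖) := by
  cases n with
  | zero => simp; nlinarith [norm_nonneg x]
  | succ n => nlinarith [(mem_herzShell_succ.mp hx).1, pow_succ (2 : ℝ) n]

/-- The volume of the unit ball. -/
noncomputable def ballVolume (d : ℕ) : ℝ := (volume (Metric.closedBall (0 : 𝔼 d) 1)).toReal

theorem ballVolume_pos (d : ℕ) : 0 < ballVolume d :=
  ENNReal.toReal_pos (Metric.measure_closedBall_pos volume _ one_pos).ne'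
    measure_closedBall_lt_top.ne

theorem volume_closedBall_two_pow (d n : ℕ) :
    volume (Metric.closedBall (0 : 𝔼 d) (2 ^ n)) =
      ENNReal.ofReal (ballVolume d * 2 ^ (n * d)) := by
  rw [Measure.addHaar_closedBall' _ _ (by positivity), ballVolume, mul_comm,
    ENNReal.ofReal_mul (by positivity), ENNReal.ofReal_toReal measure_closedBall_lt_top.ne,
    finrank_euclideanSpace, Fintype.card_fin, pow_mul]

theorem volume_herzShell_le (d n : ℕ) :
    volume (herzShell d n) ≤ ENNReal.ofReal (ballVolume d * 2 ^ (n * d)) := by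
  rw [← volume_closedBall_two_pow]
  exact measure_mono fun x hx => by simpa using norm_le_of_mem_herzShell hx

/-- The inner ball has 2^{-d} ≤ 1/2 of the volume of the outer one; this is where d ≥ 1 enters. -/
theorem le_volume_herzShell_succ {d : ℕ} (hd : 1 ≤ d) (n : ℕ) :
    ENNReal.ofReal (ballVolume d * 2 ^ ((n + 1) * d) / 2) ≤ volume (herzShell d (n + 1)) := by
  have h : herzShell d (n + 1) =
      Metric.closedBall (0 : 𝔼 d) (2 ^ (n + 1)) \ Metric.closedBall (0 : 𝔼 d) (2 ^ n) := by
    ext x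
    simp [mem_herzShell_succ, and_comm]
  rw [h, measure_sdiff (Metric.closedBall_subset_closedBall (by gcongr <;> simp))
    measurableSet_closedBall.nullMeasurableSet measure_closedBall_lt_top.ne,
    volume_closedBall_two_pow, volume_closedBall_two_pow,
    ← ENNReal.ofReal_sub _ (by have := ballVolume_pos d; positivity)]
  refine ENNReal.ofReal_le_ofReal ?_
  have h1 : (2 : ℝ) ^ ((n + 1) * d) = 2 ^ (n * d) * 2 ^ d := by rw [← pow_add]; congr 1; ring
  have h2 : (2 : ℝ) ≤ 2 ^ d := by
    simpa using pow_le_pow_right₀ (one_le_two (α := ℝ)) hd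
  have h3 : 0 < ballVolume d * 2 ^ (n * d) := by have := ballVolume_pos d; positivity
  rw [h1]
  nlinarith

/-! ## The Herz norm of nonnegative functions -/

/-- The contribution `2^{nα} ‖f χ_{D_n}‖_p` of a dyadic shell to the Herz norm. -/
noncomputable def herzShellNorm {d : ℕ} (α p : ℝ) (f : 𝔼 d → ℝ≥0∞) (n : ℕ) : ℝ≥0∞ :=
  ENNReal.ofReal (2 ^ (n * α)) * (∫⁻ x in herzShell d n, f x ^ p) ^ (1 / p)

/-- The Herz norm of a nonnegative function, as an `ℓ^q` norm over all the dyadic shells. -/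
noncomputable def herzLNorm {d : ℕ} (α p q : ℝ) (f : 𝔼 d → ℝ≥0∞) : ℝ≥0∞ :=
  seqNorm q (herzShellNorm α p f)

theorem herzShellNorm_mono {d : ℕ} {α p : ℝ} (hp : 1 ≤ p) {f g : 𝔼 d → ℝ≥0∞} {n : ℕ}
    (h : ∀ x ∈ herzShell d n, f x ≤ g x) : herzShellNorm α p f n ≤ herzShellNorm α p g n := by
  unfold herzShellNorm
  gcongr _ * ?_ ^ (1 / p)
  refine setLIntegral_mono' (measurableSet_herzShell d n) fun x hx => ?_
  gcongr
  exact h x hx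

theorem herzShellNorm_add_le {d : ℕ} {α p : ℝ} (hp : 1 ≤ p) {f g : 𝔼 d → ℝ≥0∞}
    (hf : Measurable f) (hg : Measurable g) (n : ℕ) :
    herzShellNorm α p (fun x => f x + g x) n ≤
      herzShellNorm α p f n + herzShellNorm α p g n := by
  unfold herzShellNorm
  rw [← mul_add]
  gcongr
  exact ENNReal.lintegral_Lp_add_le hf.aemeasurable hg.aemeasurable hp

theorem herzShellNorm_const_mul {d : ℕ} {α p : ℝ} (hp : 1 ≤ p) {f : 𝔼 d → ℝ≥0∞}
    (hf : Measurable f) (c : ℝ≥0∞) (n : ℕ) :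
    herzShellNorm α p (fun x => c * f x) n = c * herzShellNorm α p f n := by
  have h0 : 0 < p := by linarith
  simp only [herzShellNorm, ENNReal.mul_rpow_of_nonneg _ _ h0.le]
  rw [lintegral_const_mul _ (hf.pow_const _), ENNReal.mul_rpow_of_nonneg _ _ (by positivity),
    ← ENNReal.rpow_mul, mul_one_div_cancel h0.ne', ENNReal.rpow_one]
  ring

theorem herzLNorm_mono {d : ℕ} {α p q : ℝ} (hp : 1 ≤ p) (hq : 1 ≤ q) {f g : 𝔼 d → ℝ≥0∞}
    (h : ∀ x, f x ≤ g x) : herzLNorm α p q f ≤ herzLNorm α p q g :=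
  seqNorm_mono hq fun _ => herzShellNorm_mono hp fun x _ => h x

theorem herzLNorm_const_mul {d : ℕ} {α p q : ℝ} (hp : 1 ≤ p) (hq : 1 ≤ q) {f : 𝔼 d → ℝ≥0∞}
    (hf : Measurable f) (c : ℝ≥0∞) :
    herzLNorm α p q (fun x => c * f x) = c * herzLNorm α p q f := by
  unfold herzLNorm
  rw [← seqNorm_const_mul hq]
  congr 1
  ext n
  exact herzShellNorm_const_mul hp hf c n

theorem eLpNorm_indicator_eq_lintegral {d : ℕ} {p : ℝ} (hp : 1 ≤ p) {s : Set (𝔼 d)}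
    (hs : MeasurableSet s) (f : 𝔼 d → ℂ) :
    eLpNorm (s.indicator f) (ENNReal.ofReal p) volume = (∫⁻ x in s, ‖f x‖ₑ ^ p) ^ (1 / p) := by
  rw [eLpNorm_indicator_eq_eLpNorm_restrict hs,
    eLpNorm_eq_lintegral_rpow_enorm_toReal (by simpa using by linarith) ENNReal.ofReal_ne_top,
    ENNReal.toReal_ofReal (by linarith)]

theorem herzShellNorm_enorm {d : ℕ} {α p : ℝ} (hp : 1 ≤ p) (f : 𝔼 d → ℂ) (n : ℕ) :
    herzShellNorm α p (fun x => ‖f x‖ₑ) n = ENNReal.ofReal (2 ^ (n * α)) *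
      eLpNorm ((herzShell d n).indicator f) (ENNReal.ofReal p) volume := by
  rw [eLpNorm_indicator_eq_lintegral hp (measurableSet_herzShell d n)]
  rfl

theorem herzENorm_eq {d : ℕ} {α p q : ℝ} (hp : 1 ≤ p) (hq : 1 ≤ q) (f : 𝔼 d → ℂ) :
    herzENorm α p q f = herzShellNorm α p (fun x => ‖f x‖ₑ) 0 +
      seqNorm q (fun n => herzShellNorm α p (fun x => ‖f x‖ₑ) (n + 1)) := by
  have h0 : 0 < q := by linarith
  simp only [herzShellNorm_enorm hp, herzShell_zero, herzShell_succ, seqNorm]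
  simp only [ENNReal.mul_rpow_of_nonneg _ _ h0.le,
    ENNReal.ofReal_rpow_of_nonneg (Real.rpow_nonneg zero_le_two _) h0.le,
    ← Real.rpow_mul zero_le_two]
  simp [herzENorm]

theorem herzLNorm_le_herzENorm {d : ℕ} {α p q : ℝ} (hp : 1 ≤ p) (hq : 1 ≤ q) (f : 𝔼 d → ℂ) :
    herzLNorm α p q (fun x => ‖f x‖ₑ) ≤ herzENorm α p q f := by
  rw [herzENorm_eq hp hq]
  exact seqNorm_le_zero_add_succ hq _

/-- Each of the two summands of the Herz norm is at most the ℓ^q norm over all shells. Together with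
`herzLNorm_le_herzENorm` this makes the two norms equivalent, and all estimates are done with
`herzLNorm`. -/
theorem herzENorm_le_two_mul {d : ℕ} {α p q : ℝ} (hp : 1 ≤ p) (hq : 1 ≤ q) (f : 𝔼 d → ℂ) :
    herzENorm α p q f ≤ 2 * herzLNorm α p q (fun x => ‖f x‖ₑ) := by
  rw [herzENorm_eq hp hq, two_mul]
  exact add_le_add (le_seqNorm hq _ 0) (seqNorm_comp_succ_le hq _)

/-! ## Functions with decay -/

/-- A decay exponent that is sufficient for all estimates in the Herz space. -/
noncomputable def herzDecay (d : ℕ) (α : ℝ) : ℕ := 2 * (d + ⌈|α|⌉₊ + 1)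

theorem le_herzDecay (d : ℕ) (α : ℝ) : 2 * (d + |α| + 1) ≤ herzDecay d α := by
  unfold herzDecay
  push_cast
  linarith [Nat.le_ceil |α|]

theorem tsum_two_rpow_neg_abs_lt_top {g : ℝ} (hg : 0 < g) :
    ∑' k : ℤ, ENNReal.ofReal ((2 : ℝ) ^ (-(g * |(k : ℝ)|))) < ∞ := by
  have hr : (2 : ℝ) ^ (-g) < 1 := Real.rpow_lt_one_of_one_lt_of_neg one_lt_two (by linarith)
  have hs : Summable fun n : ℕ => (2 : ℝ) ^ (-(g * n)) := by
    have := summable_geometric_of_lt_one (Real.rpow_nonneg zero_le_two (-g)) hr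
    refine this.congr fun n => ?_
    rw [← Real.rpow_natCast, ← Real.rpow_mul zero_le_two, neg_mul]
  have hz : Summable fun k : ℤ => (2 : ℝ) ^ (-(g * |(k : ℝ)|)) :=
    Summable.of_nat_of_neg (by simpa using hs) (by simpa using hs)
  rw [← ENNReal.ofReal_tsum_of_nonneg (fun k => by positivity) hz]
  exact ENNReal.ofReal_lt_top

/-- The function `(1 + 2^{-N} |x|)^{-L}`. -/
noncomputable def decayFun {d : ℕ} (L N : ℕ) (x : 𝔼 d) : ℝ≥0∞ :=
  ENNReal.ofReal ((1 + ((2 : ℝ) ^ N)⁻¹ * ‖x‖) ^ L)⁻¹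

theorem measurable_decayFun {d : ℕ} (L N : ℕ) : Measurable (decayFun L N : 𝔼 d → ℝ≥0∞) := by
  unfold decayFun
  fun_prop

/-- For n ≤ N the decay factor is at most 1 and the weight itself decreases geometrically away from
N. For n = N + k + 1 the decay factor is at most 2^{-kL} ≤ 2^{-2gk}, which beats the growth of the
weight; the shift from k to k + 1 costs 2^{2g}. -/
theorem two_rpow_mul_decay_le {d : ℕ} {g : ℝ} (hg : 0 < g) {L : ℕ} (hL : 2 * g ≤ L) (N n : ℕ)
    {x : 𝔼 d} (hx : x ∈ herzShell d n) :
    (2 : ℝ) ^ (n * g) * ((1 + ((2 : ℝ) ^ N)⁻¹ * ‖x‖) ^ L)⁻¹ ≤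
      2 ^ (2 * g) * 2 ^ (N * g) * 2 ^ (-(g * |(((n : ℤ) - N : ℤ) : ℝ)|)) := by
  have h2 : (0 : ℝ) < 2 := two_pos
  rw [← Real.rpow_add h2, ← Real.rpow_add h2]
  rcases le_or_gt n N with h | h
  · have h1 : (1 : ℝ) ≤ (1 + ((2 : ℝ) ^ N)⁻¹ * ‖x‖) ^ L :=
      one_le_pow₀ (by have := norm_nonneg x; linarith [show 0 ≤ ((2 : ℝ) ^ N)⁻¹ * ‖x‖ by positivity])
    have habs : (|(((n : ℤ) - N : ℤ) : ℝ)|) = N - n := by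
      push_cast
      rw [abs_of_nonpos (by simpa using h)]
      ring
    calc (2 : ℝ) ^ (n * g) * ((1 + ((2 : ℝ) ^ N)⁻¹ * ‖x‖) ^ L)⁻¹ ≤ 2 ^ (n * g) * 1 := by
          gcongr
          exact inv_le_one_of_one_le₀ h1
      _ ≤ _ := by
          rw [mul_one]
          refine Real.rpow_le_rpow_of_exponent_le one_le_two ?_
          push_cast at habs ⊢
          rw [habs]
          nlinarith
  · obtain ⟨k, rfl⟩ := Nat.exists_eq_add_of_lt h
    have hlt := (mem_herzShell_succ.mp hx).1
    have h1 : (2 : ℝ) ^ k ≤ 1 + ((2 : ℝ) ^ N)⁻¹ * ‖x‖ := by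
      have : (2 : ℝ) ^ k = ((2 : ℝ) ^ N)⁻¹ * 2 ^ (N + k) := by
        rw [pow_add]; field_simp
      rw [this]
      nlinarith [show (0 : ℝ) < ((2 : ℝ) ^ N)⁻¹ by positivity]
    have h3 : (2 : ℝ) ^ (2 * g * k) ≤ (1 + ((2 : ℝ) ^ N)⁻¹ * ‖x‖) ^ L := by
      calc (2 : ℝ) ^ (2 * g * k) ≤ 2 ^ ((k : ℝ) * L) := by
            refine Real.rpow_le_rpow_of_exponent_le one_le_two ?_
            nlinarith [Nat.cast_nonneg (α := ℝ) k]
        _ = (2 ^ k) ^ L := by rw [← Nat.cast_mul, Real.rpow_natCast, pow_mul]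
        _ ≤ _ := by gcongr
    have habs : (|(((N + k + 1 : ℕ) - N : ℤ) : ℝ)|) = k + 1 := by
      push_cast
      rw [abs_of_nonneg (by linarith [Nat.cast_nonneg (α := ℝ) k])]
      ring
    calc (2 : ℝ) ^ ((N + k + 1 : ℕ) * g) * ((1 + ((2 : ℝ) ^ N)⁻¹ * ‖x‖) ^ L)⁻¹
        ≤ 2 ^ ((N + k + 1 : ℕ) * g) * (2 ^ (2 * g * k))⁻¹ := by gcongr
      _ = 2 ^ ((N + k + 1 : ℕ) * g - 2 * g * k) := by
          rw [← Real.rpow_neg h2.le, ← Real.rpow_add h2, sub_eq_add_neg]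
      _ ≤ _ := by
          refine Real.rpow_le_rpow_of_exponent_le one_le_two ?_
          push_cast at habs ⊢
          rw [habs]
          linarith

/-- The factor |D_n|^{1/p} ≲ 2^{nd/p} turns the weight 2^{nα} into 2^{n(α + d/p)}, the exponent on
which the condition on α bears. -/
theorem herzShellNorm_le_of_bound {d : ℕ} {α p : ℝ} (hp : 1 ≤ p) {f : 𝔼 d → ℝ≥0∞} {n : ℕ}
    {c : ℝ} (hc : 0 ≤ c) (h : ∀ x ∈ herzShell d n, f x ≤ ENNReal.ofReal c) :
    herzShellNorm α p f n ≤
      ENNReal.ofReal (ballVolume d ^ (1 / p) * (2 ^ (n * (α + d / p)) * c)) := by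
  have h0 : 0 < p := by linarith
  have hv := (ballVolume_pos d).le
  have h1 : ∫⁻ x in herzShell d n, f x ^ p ≤
      ENNReal.ofReal (c ^ p * (ballVolume d * 2 ^ (n * d))) := by
    calc ∫⁻ x in herzShell d n, f x ^ p
        ≤ ∫⁻ _ in herzShell d n, ENNReal.ofReal c ^ p :=
          setLIntegral_mono' (measurableSet_herzShell d n) fun x hx => by gcongr; exact h x hx
      _ = ENNReal.ofReal c ^ p * volume (herzShell d n) := by simp
      _ ≤ ENNReal.ofReal c ^ p * ENNReal.ofReal (ballVolume d * 2 ^ (n * d)) := by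
          gcongr; exact volume_herzShell_le d n
      _ = _ := by rw [ENNReal.ofReal_rpow_of_nonneg hc h0.le,
            ENNReal.ofReal_mul (p := c ^ p) (by positivity)]
  calc herzShellNorm α p f n
      ≤ ENNReal.ofReal (2 ^ (n * α)) *
        ENNReal.ofReal (c ^ p * (ballVolume d * 2 ^ (n * d))) ^ (1 / p) := by
        unfold herzShellNorm; gcongr
    _ = ENNReal.ofReal (2 ^ (n * α) * (c ^ p * (ballVolume d * 2 ^ (n * d))) ^ (1 / p)) := by
        rw [ENNReal.ofReal_rpow_of_nonneg (by positivity) (by positivity),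
          ← ENNReal.ofReal_mul (by positivity)]
    _ = _ := by
        congr 1
        rw [Real.mul_rpow (by positivity) (by positivity), Real.mul_rpow hv (by positivity),
          ← Real.rpow_mul hc, mul_one_div_cancel h0.ne', Real.rpow_one, mul_add,
          Real.rpow_add two_pos, ← Real.rpow_natCast, ← Real.rpow_mul zero_le_two]
        push_cast
        rw [show (n : ℝ) * d * (1 / p) = n * (d / p) by ring]
        ring

/-- Because α + d/p > 0, the shell norms decay geometrically on both sides of n = N. Comparison with
a series over all of ℤ makes the constant independent of N, which the wave packets require. -/
theorem exists_herzLNorm_decayFun_le {d : ℕ} {α p q : ℝ} (hp : 1 ≤ p) (hq : 1 ≤ q)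
    (hα : -(d : ℝ) / p < α) :
    ∃ C : ℝ≥0, ∀ N : ℕ, herzLNorm α p q (decayFun (herzDecay d α) N : 𝔼 d → ℝ≥0∞) ≤
      C * ENNReal.ofReal (2 ^ (N * (α + d / p))) := by
  have hg : 0 < α + d / p := by
    have : -(d : ℝ) / p = -(d / p) := by ring
    linarith
  set g := α + d / p with hgdef
  have hL : 2 * g ≤ herzDecay d α := by
    have h1 : (d : ℝ) / p ≤ d := div_le_self (Nat.cast_nonneg d) hp
    linarith [le_herzDecay d α, le_abs_self α]
  have hv := (ballVolume_pos d).le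
  refine ⟨(ENNReal.ofReal (ballVolume d ^ (1 / p) * 2 ^ (2 * g)) *
    ∑' k : ℤ, ENNReal.ofReal ((2 : ℝ) ^ (-(g * |(k : ℝ)|)))).toNNReal, fun N => ?_⟩
  rw [ENNReal.coe_toNNReal (ENNReal.mul_lt_top ENNReal.ofReal_lt_top
    (tsum_two_rpow_neg_abs_lt_top hg)).ne]
  have key : ∀ n : ℕ, herzShellNorm α p (decayFun (herzDecay d α) N : 𝔼 d → ℝ≥0∞) n ≤
      ENNReal.ofReal (ballVolume d ^ (1 / p) * 2 ^ (2 * g)) * ENNReal.ofReal (2 ^ (N * g)) *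
        ENNReal.ofReal ((2 : ℝ) ^ (-(g * |(((n : ℤ) - N : ℤ) : ℝ)|))) := fun n => by
    refine (herzShellNorm_le_of_bound hp
      (c := (2 ^ (n * g))⁻¹ *
        (2 ^ (2 * g) * 2 ^ (N * g) * 2 ^ (-(g * |(((n : ℤ) - N : ℤ) : ℝ)|)))) (by positivity)
      fun x hx => ENNReal.ofReal_le_ofReal ?_).trans ?_
    · rw [le_inv_mul_iff₀ (by positivity)]
      exact two_rpow_mul_decay_le hg hL N n hx
    · rw [← ENNReal.ofReal_mul (by positivity), ← ENNReal.ofReal_mul (by positivity),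
        mul_inv_cancel_left₀ (by positivity)]
      refine ENNReal.ofReal_le_ofReal (le_of_eq ?_)
      ring
  refine (seqNorm_le_tsum hq _).trans ((ENNReal.tsum_le_tsum key).trans ?_)
  rw [ENNReal.tsum_mul_left, mul_right_comm]
  gcongr
  exact ENNReal.tsum_comp_le_tsum_of_injective (f := fun n : ℕ => (n : ℤ) - N)
    (fun a b h => by simpa using h) fun k : ℤ => ENNReal.ofReal ((2 : ℝ) ^ (-(g * |(k : ℝ)|)))

/-! ## Convolution with rapidly decaying kernels -/

/-- **Young's inequality** `L^1 * L^p ⊆ L^p` for nonnegative functions. -/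
theorem lintegral_rpow_convolution_le {d : ℕ} {p : ℝ} (hp : 1 ≤ p) {κ h : 𝔼 d → ℝ≥0∞}
    (hκ : Measurable κ) (hh : Measurable h) :
    (∫⁻ x, (∫⁻ y, κ (x - y) * h y) ^ p) ^ (1 / p) ≤
      (∫⁻ x, κ x) * (∫⁻ x, h x ^ p) ^ (1 / p) := by
  have h0 : 0 < p := by linarith
  have hinv : 1 / p ≤ 1 := by rw [div_le_one h0]; exact hp
  set K := ∫⁻ x, κ x with hK
  have hKx : ∀ x : 𝔼 d, ∫⁻ y, κ (x - y) = K := fun x =>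
    lintegral_sub_left_eq_self κ x
  have hKy : ∀ y : 𝔼 d, ∫⁻ x, κ (x - y) = K := fun y =>
    lintegral_sub_right_eq_self κ y
  have hpt : ∀ x, (∫⁻ y, κ (x - y) * h y) ^ p ≤ K ^ (p - 1) * ∫⁻ y, κ (x - y) * h y ^ p := by
    intro x
    -- Hölder with weights 1 - 1/p and 1/p: part of the kernel is integrated alone, the rest stays
    -- with h^p.
    have hsplit : ∀ y, κ (x - y) * h y =
        κ (x - y) ^ (1 - 1 / p) * (κ (x - y) * h y ^ p) ^ (1 / p) := fun y => by
      rw [ENNReal.mul_rpow_of_nonneg _ _ (by positivity), ← ENNReal.rpow_mul,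
        mul_one_div_cancel h0.ne', ENNReal.rpow_one, ← mul_assoc,
        ← ENNReal.rpow_add_of_nonneg _ _ (by linarith) (by positivity), sub_add_cancel,
        ENNReal.rpow_one]
    have hH := ENNReal.lintegral_mul_norm_pow_le (μ := (volume : Measure (𝔼 d)))
      (f := fun y => κ (x - y)) (g := fun y => κ (x - y) * h y ^ p)
      (by fun_prop) (by fun_prop) (p := 1 - 1 / p) (q := 1 / p) (by linarith) (by positivity)
      (by ring)
    simp only [← hsplit] at hH
    rw [hKx] at hH
    calc (∫⁻ y, κ (x - y) * h y) ^ p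
        ≤ (K ^ (1 - 1 / p) * (∫⁻ y, κ (x - y) * h y ^ p) ^ (1 / p)) ^ p := by gcongr
      _ = _ := by
          rw [ENNReal.mul_rpow_of_nonneg _ _ h0.le, ← ENNReal.rpow_mul, ← ENNReal.rpow_mul,
            one_div_mul_cancel h0.ne', ENNReal.rpow_one]
          congr 2
          field_simp
  have hint : ∫⁻ x, (∫⁻ y, κ (x - y) * h y) ^ p ≤ K ^ p * ∫⁻ y, h y ^ p := by
    have hm : Measurable (Function.uncurry fun x y : 𝔼 d => κ (x - y) * h y ^ p) := by
      unfold Function.uncurry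
      fun_prop
    calc ∫⁻ x, (∫⁻ y, κ (x - y) * h y) ^ p
        ≤ ∫⁻ x, K ^ (p - 1) * ∫⁻ y, κ (x - y) * h y ^ p := lintegral_mono hpt
      _ = K ^ (p - 1) * ∫⁻ x, ∫⁻ y, κ (x - y) * h y ^ p := lintegral_const_mul _ (by
          exact hm.lintegral_prod_right)
      _ = K ^ (p - 1) * ∫⁻ y, ∫⁻ x, κ (x - y) * h y ^ p := by
          rw [lintegral_lintegral_swap hm.aemeasurable]
      _ = K ^ (p - 1) * (K * ∫⁻ y, h y ^ p) := by
          congr 1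
          rw [← lintegral_const_mul _ (by fun_prop)]
          refine lintegral_congr fun y => ?_
          rw [lintegral_mul_const _ (by fun_prop), hKy]
      _ = _ := by
          rw [← mul_assoc]
          congr 1
          conv_lhs => rw [← ENNReal.rpow_one K, ← ENNReal.rpow_mul, one_mul]
          rw [← ENNReal.rpow_add_of_nonneg _ _ (by linarith) zero_le_one, sub_add_cancel]
  calc (∫⁻ x, (∫⁻ y, κ (x - y) * h y) ^ p) ^ (1 / p) ≤ (K ^ p * ∫⁻ y, h y ^ p) ^ (1 / p) := by
        gcongr
    _ = _ := by
        rw [ENNReal.mul_rpow_of_nonneg _ _ (by positivity), ← ENNReal.rpow_mul,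
          mul_one_div_cancel h0.ne', ENNReal.rpow_one]

theorem lintegral_decayFun_lt_top {d L : ℕ} (hL : d < L) :
    ∫⁻ x, (decayFun L 0 x : ℝ≥0∞) ∂(volume : Measure (𝔼 d)) < ∞ := by
  have h := finite_integral_one_add_norm (E := 𝔼 d) (μ := volume) (r := (L : ℝ))
    (by simpa using hL)
  refine lt_of_eq_of_lt (lintegral_congr fun x => ?_) h
  rw [decayFun, Real.rpow_neg (by positivity), Real.rpow_natCast]
  simp

/-- The union of a dyadic shell with its two neighbours. -/
def nearShells (d n : ℕ) : Set (𝔼 d) :=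
  herzShell d (n - 1) ∪ herzShell d n ∪ herzShell d (n + 1)

theorem measurableSet_nearShells (d n : ℕ) : MeasurableSet (nearShells d n) :=
  ((measurableSet_herzShell d _).union (measurableSet_herzShell d _)).union
    (measurableSet_herzShell d _)

/-- Points in non-adjacent shells satisfy |x|, |y| ≤ 2|x - y|, so (1 + |x|)(1 + |y|) ≤ 4(1 + |x -
y|)². Half of the decay is thus available for each variable, and the kernel is dominated by a
rank-one kernel. -/
theorem decay_sub_le_of_notMem_nearShells {d n : ℕ} {x y : 𝔼 d} (hx : x ∈ herzShell d n)
    (hy : y ∉ nearShells d n) (L : ℕ) :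
    (decayFun (2 * L) 0 (x - y) : ℝ≥0∞) ≤
      ENNReal.ofReal (4 ^ L) * (decayFun L 0 x * decayFun L 0 y) := by
  obtain ⟨m, hm⟩ := exists_mem_herzShell y
  have hdist : (1 + ‖x‖) * (1 + ‖y‖) ≤ 4 * (1 + ‖x - y‖) ^ 2 := by
    have h1 := norm_nonneg x
    have h2 := norm_nonneg y
    have h3 := norm_nonneg (x - y)
    suffices h : ‖x‖ ≤ 2 * ‖x - y‖ ∧ ‖y‖ ≤ 2 * ‖x - y‖ by nlinarith [h.1, h.2]
    have hmn : m ≠ n - 1 ∧ m ≠ n ∧ m ≠ n + 1 := by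
      refine ⟨?_, ?_, ?_⟩ <;> rintro rfl <;> simp [nearShells, hm] at hy
    have key : ∀ {a b : ℕ} {u v : 𝔼 d}, u ∈ herzShell d a → v ∈ herzShell d b → a + 1 < b →
        2 * ‖u‖ ≤ ‖v‖ := fun {a b u v} hu hv hab => by
      have h4 := norm_le_of_mem_herzShell hu
      have h5 := lt_norm_of_mem_herzShell hv hab
      rw [pow_succ] at h5
      linarith
    rcases lt_or_ge n m with h | h
    · have h6 := key hx hm (by omega)
      have h7 := norm_sub_norm_le y x
      rw [norm_sub_rev] at h7
      constructor <;> linarith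
    · have h6 := key hm hx (by omega)
      have h7 := norm_sub_norm_le x y
      constructor <;> linarith
  simp only [decayFun]
  rw [← ENNReal.ofReal_mul (by positivity), ← ENNReal.ofReal_mul (by positivity)]
  refine ENNReal.ofReal_le_ofReal ?_
  simp only [pow_zero, inv_one, one_mul]
  rw [← mul_inv, ← mul_pow, ← div_eq_mul_inv, le_div_iff₀ (by positivity), ← div_eq_inv_mul,
    div_le_iff₀ (by positivity), pow_mul, ← mul_pow]
  gcongr

/-- Hölder on each shell costs only a fixed power of 2^n, which the decay outweighs. The resulting
embedding into a weighted L¹ controls the interaction of distant shells, gives almost everywhere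
convergence, and identifies limits taken in different norms. -/
theorem lintegral_decayFun_mul_le {d : ℕ} {α p q : ℝ} (hp : 1 ≤ p) (hq : 1 ≤ q) :
    ∃ C : ℝ≥0, ∀ g : 𝔼 d → ℝ≥0∞, Measurable g →
      ∫⁻ y, decayFun (herzDecay d α) 0 y * g y ≤ C * herzLNorm α p q g := by
  have h0 : 0 < p := by linarith
  have hinv : 1 / p ≤ 1 := by rw [div_le_one h0]; exact hp
  set L := herzDecay d α with hL
  have hv := (ballVolume_pos d).le
  set c : ℝ := 2 ^ L * ballVolume d ^ (1 - 1 / p) with hc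
  have hc0 : 0 ≤ c := by positivity
  refine ⟨(2 * c).toNNReal, fun g hg => ?_⟩
  have hshell : ∀ n : ℕ, ∫⁻ y in herzShell d n, decayFun L 0 y * g y ≤
      ENNReal.ofReal (c * (1 / 2) ^ n) * herzLNorm α p q g := by
    intro n
    have hH : ∫⁻ y in herzShell d n, g y ≤
        ENNReal.ofReal (ballVolume d * 2 ^ (n * d)) ^ (1 - 1 / p) *
          (∫⁻ y in herzShell d n, g y ^ p) ^ (1 / p) := by
      have h := ENNReal.lintegral_mul_norm_pow_le (μ := volume.restrict (herzShell d n))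
        (f := fun _ => 1) (g := fun y => g y ^ p) (by fun_prop) (by fun_prop)
        (p := 1 - 1 / p) (q := 1 / p) (by linarith) (by positivity) (by ring)
      simp only [ENNReal.one_rpow, one_mul, ← ENNReal.rpow_mul, mul_one_div_cancel h0.ne',
        ENNReal.rpow_one, lintegral_const, Measure.restrict_apply_univ] at h
      refine h.trans ?_
      gcongr
      exact volume_herzShell_le d n
    have hs : (∫⁻ y in herzShell d n, g y ^ p) ^ (1 / p) ≤
        ENNReal.ofReal (2 ^ (-(n * α))) * herzLNorm α p q g := by
      have h := le_seqNorm hq (herzShellNorm α p g) n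
      calc (∫⁻ y in herzShell d n, g y ^ p) ^ (1 / p)
          = ENNReal.ofReal (2 ^ (-(n * α))) * herzShellNorm α p g n := by
            rw [herzShellNorm, ← mul_assoc, ← ENNReal.ofReal_mul (by positivity),
              ← Real.rpow_add two_pos, neg_add_cancel, Real.rpow_zero, ENNReal.ofReal_one, one_mul]
        _ ≤ _ := by gcongr; exact h
    have hdec : ∀ y ∈ herzShell d n, (decayFun L 0 y : ℝ≥0∞) ≤
        ENNReal.ofReal (2 ^ L * (2 ^ (n * L))⁻¹) := fun y hy => by
      refine ENNReal.ofReal_le_ofReal ?_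
      have h := half_two_pow_le hy
      simp only [pow_zero, inv_one, one_mul]
      rw [← div_eq_mul_inv, le_div_iff₀ (by positivity), ← div_eq_inv_mul,
        div_le_iff₀ (by positivity), pow_mul, ← mul_pow]
      gcongr
    have hexp : (2 : ℝ) ^ L * (2 ^ (n * L))⁻¹ * ((ballVolume d * 2 ^ (n * d)) ^ (1 - 1 / p) *
        2 ^ (-(n * α))) ≤ c * (1 / 2) ^ n := by
      rw [Real.mul_rpow hv (by positivity), hc]
      have hhalf : ((1 : ℝ) / 2) ^ n = 2 ^ (-(n : ℝ)) := by
        rw [Real.rpow_neg zero_le_two, Real.rpow_natCast, one_div, inv_pow]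
      -- The exponent is n(d(1 - 1/p) - α - L), at most -n since L ≥ 2(d + |α| + 1).
      have h1 : ((2 : ℝ) ^ (n * L))⁻¹ * (((2 : ℝ) ^ (n * d)) ^ (1 - 1 / p) * 2 ^ (-(n * α))) ≤
          (1 / 2) ^ n := by
        rw [← Real.rpow_natCast 2 (n * L), ← Real.rpow_natCast 2 (n * d),
          ← Real.rpow_mul zero_le_two, ← Real.rpow_neg zero_le_two, ← Real.rpow_add two_pos,
          ← Real.rpow_add two_pos, hhalf]
        refine Real.rpow_le_rpow_of_exponent_le one_le_two ?_
        push_cast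
        have h2 := le_herzDecay d α
        have h3 := neg_abs_le α
        have h4 : (d : ℝ) * (1 - 1 / p) ≤ d :=
          mul_le_of_le_one_right (Nat.cast_nonneg d) (by linarith [show 0 ≤ 1 / p by positivity])
        have h5 : 0 ≤ (n : ℝ) * (L - d * (1 - 1 / p) + α - 1) :=
          mul_nonneg (Nat.cast_nonneg n) (by
            linarith [abs_nonneg α, Nat.cast_nonneg (α := ℝ) d])
        linarith
      have h6 : 0 ≤ (2 : ℝ) ^ L * ballVolume d ^ (1 - 1 / p) := hc0
      calc _ = (2 : ℝ) ^ L * ballVolume d ^ (1 - 1 / p) * (((2 : ℝ) ^ (n * L))⁻¹ *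
            (((2 : ℝ) ^ (n * d)) ^ (1 - 1 / p) * 2 ^ (-(n * α)))) := by ring
        _ ≤ _ := by gcongr
    calc ∫⁻ y in herzShell d n, decayFun L 0 y * g y
        ≤ ∫⁻ y in herzShell d n, ENNReal.ofReal (2 ^ L * (2 ^ (n * L))⁻¹) * g y :=
          setLIntegral_mono' (measurableSet_herzShell d n) fun y hy => by
            gcongr; exact hdec y hy
      _ = ENNReal.ofReal (2 ^ L * (2 ^ (n * L))⁻¹) * ∫⁻ y in herzShell d n, g y :=
          lintegral_const_mul _ hg
      _ ≤ ENNReal.ofReal (2 ^ L * (2 ^ (n * L))⁻¹) *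
          (ENNReal.ofReal (ballVolume d * 2 ^ (n * d)) ^ (1 - 1 / p) *
            (ENNReal.ofReal (2 ^ (-(n * α))) * herzLNorm α p q g)) := by
          gcongr
          exact hH.trans (by gcongr)
      _ = ENNReal.ofReal (2 ^ L * (2 ^ (n * L))⁻¹ * ((ballVolume d * 2 ^ (n * d)) ^ (1 - 1 / p) *
            2 ^ (-(n * α)))) * herzLNorm α p q g := by
          rw [ENNReal.ofReal_rpow_of_nonneg (by positivity) (by linarith),
            ENNReal.ofReal_mul (p := 2 ^ L * (2 ^ (n * L))⁻¹) (by positivity),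
            ENNReal.ofReal_mul (p := (ballVolume d * 2 ^ (n * d)) ^ (1 - 1 / p)) (by positivity)]
          ring
      _ ≤ _ := by gcongr
  rw [lintegral_eq_tsum_herzShell]
  refine (ENNReal.tsum_le_tsum hshell).trans ?_
  rw [ENNReal.tsum_mul_right]
  gcongr
  rw [← ENNReal.ofReal_tsum_of_nonneg (fun n => by positivity)
    (summable_geometric_two.mul_left c), tsum_mul_left, tsum_geometric_two, mul_comm c]
  rfl

/-- Young's inequality in unweighted L^p suffices, as the weights of neighbouring shells differ by
at most a factor 2^{|α|}. -/
theorem herzShellNorm_nearShells_le {d : ℕ} {α p : ℝ} (hp : 1 ≤ p) {κ g : 𝔼 d → ℝ≥0∞}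
    (hκ : Measurable κ) (hg : Measurable g) (n : ℕ) :
    herzShellNorm α p (fun x => ∫⁻ y, κ (x - y) * (nearShells d n).indicator g y) n ≤
      ENNReal.ofReal (2 ^ |α|) * (∫⁻ x, κ x) * (herzShellNorm α p g (n - 1) +
        herzShellNorm α p g n + herzShellNorm α p g (n + 1)) := by
  have h0 : 0 < p := by linarith
  have hinv : 1 / p ≤ 1 := by rw [div_le_one h0]; exact hp
  have hadd : ∀ a b : ℝ≥0∞, (a + b) ^ (1 / p) ≤ a ^ (1 / p) + b ^ (1 / p) := fun a b =>
    ENNReal.rpow_add_le_add_rpow a b (by positivity) hinv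
  have hw : ∀ m : ℕ, n ≤ m + 1 → m ≤ n + 1 → ∀ a : ℝ≥0∞, ENNReal.ofReal (2 ^ (n * α)) * a ≤
      ENNReal.ofReal (2 ^ |α|) * (ENNReal.ofReal (2 ^ (m * α)) * a) := by
    intro m h1 h2 a
    rw [← mul_assoc, ← ENNReal.ofReal_mul (by positivity), ← Real.rpow_add two_pos]
    gcongr
    · exact one_le_two
    · have h3 : (n : ℝ) ≤ m + 1 := by exact_mod_cast h1
      have h4 : (m : ℝ) ≤ n + 1 := by exact_mod_cast h2
      have h5 : ((n : ℝ) - m) * α ≤ |(n : ℝ) - m| * |α| := by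
        rw [← abs_mul]; exact le_abs_self _
      have h6 : |(n : ℝ) - m| ≤ 1 := abs_le.mpr ⟨by linarith, by linarith⟩
      nlinarith [abs_nonneg α]
  have hnear : ∫⁻ x, (nearShells d n).indicator g x ^ p ≤ (∫⁻ x in herzShell d (n - 1), g x ^ p) +
      (∫⁻ x in herzShell d n, g x ^ p) + ∫⁻ x in herzShell d (n + 1), g x ^ p := by
    have h1 : ∀ x, (nearShells d n).indicator g x ^ p =
        (nearShells d n).indicator (fun x => g x ^ p) x := fun x => by
      by_cases hx : x ∈ nearShells d n <;> simp [hx, h0]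
    simp only [h1]
    rw [lintegral_indicator (measurableSet_nearShells d n)]
    exact (lintegral_union_le _ _ _).trans (add_le_add (lintegral_union_le _ _ _) le_rfl)
  calc herzShellNorm α p (fun x => ∫⁻ y, κ (x - y) * (nearShells d n).indicator g y) n
      ≤ ENNReal.ofReal (2 ^ (n * α)) *
        (∫⁻ x, (∫⁻ y, κ (x - y) * (nearShells d n).indicator g y) ^ p) ^ (1 / p) := by
        unfold herzShellNorm
        gcongr
        exact Measure.restrict_le_self
    _ ≤ ENNReal.ofReal (2 ^ (n * α)) * ((∫⁻ x, κ x) *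
        ((∫⁻ x in herzShell d (n - 1), g x ^ p) ^ (1 / p) +
          (∫⁻ x in herzShell d n, g x ^ p) ^ (1 / p) +
          (∫⁻ x in herzShell d (n + 1), g x ^ p) ^ (1 / p))) := by
        gcongr
        refine (lintegral_rpow_convolution_le hp hκ
          (hg.indicator (measurableSet_nearShells d n))).trans ?_
        gcongr
        exact (ENNReal.rpow_le_rpow hnear (by positivity)).trans
          ((hadd _ _).trans (add_le_add (hadd _ _) le_rfl))
    _ = (∫⁻ x, κ x) *
        (ENNReal.ofReal (2 ^ (n * α)) * (∫⁻ x in herzShell d (n - 1), g x ^ p) ^ (1 / p) +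
          ENNReal.ofReal (2 ^ (n * α)) * (∫⁻ x in herzShell d n, g x ^ p) ^ (1 / p) +
          ENNReal.ofReal (2 ^ (n * α)) * (∫⁻ x in herzShell d (n + 1), g x ^ p) ^ (1 / p)) := by
        ring
    _ ≤ (∫⁻ x, κ x) * (ENNReal.ofReal (2 ^ |α|) * herzShellNorm α p g (n - 1) +
        ENNReal.ofReal (2 ^ |α|) * herzShellNorm α p g n +
        ENNReal.ofReal (2 ^ |α|) * herzShellNorm α p g (n + 1)) := by
        exact mul_le_mul' le_rfl (add_le_add (add_le_add (hw _ (by omega) (by omega) _)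
          (hw _ (by omega) (by omega) _)) (hw _ (by omega) (by omega) _))
    _ = _ := by ring

/-- Convolution with a rapidly decaying kernel is bounded in the Herz norm. -/
theorem exists_herzLNorm_convolution_le {d : ℕ} {α p q : ℝ} (hp : 1 ≤ p) (hq : 1 ≤ q)
    (hα : -(d : ℝ) / p < α) :
    ∃ C : ℝ≥0, ∀ g : 𝔼 d → ℝ≥0∞, Measurable g →
      herzLNorm α p q (fun x => ∫⁻ y, decayFun (2 * herzDecay d α) 0 (x - y) * g y) ≤
        C * herzLNorm α p q g := by
  obtain ⟨C₁, hC₁⟩ := exists_herzLNorm_decayFun_le (d := d) hp hq hα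
  obtain ⟨C₂, hC₂⟩ := lintegral_decayFun_mul_le (d := d) (α := α) hp hq
  set L := herzDecay d α with hL
  set κ : 𝔼 d → ℝ≥0∞ := decayFun (2 * L) 0 with hκ
  have hκm : Measurable κ := measurable_decayFun _ _
  have hKtop : ∫⁻ x, κ x ≠ ∞ := (lintegral_decayFun_lt_top (by
    rw [hL, herzDecay]; omega)).ne
  lift (∫⁻ x, κ x) to ℝ≥0 using hKtop with K hK
  -- The near part contributes 4 = 2 + 1 + 1, from the shell before, the shell itself and the shell
  -- after; the second term bounds the rank-one far part.
  refine ⟨(2 ^ |α| : ℝ).toNNReal * K * 4 + (4 ^ L : ℝ).toNNReal * C₂ * C₁, fun g hg => ?_⟩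
  set I := ∫⁻ y, decayFun L 0 y * g y with hI
  have hbound : ∀ n, herzShellNorm α p (fun x => ∫⁻ y, κ (x - y) * g y) n ≤
      ENNReal.ofReal (2 ^ |α|) * K * (herzShellNorm α p g (n - 1) +
        herzShellNorm α p g n + herzShellNorm α p g (n + 1)) +
      ENNReal.ofReal (4 ^ L) * I * herzShellNorm (d := d) α p (decayFun L 0) n := by
    intro n
    have hm : Measurable fun x => ∫⁻ y, κ (x - y) * (nearShells d n).indicator g y := by
      have := hg.indicator (measurableSet_nearShells d n)
      exact Measurable.lintegral_prod_right (f := fun x y =>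
        κ (x - y) * (nearShells d n).indicator g y) (by unfold Function.uncurry; fun_prop)
    have hpt : ∀ x ∈ herzShell d n, ∫⁻ y, κ (x - y) * g y ≤
        (∫⁻ y, κ (x - y) * (nearShells d n).indicator g y) +
          ENNReal.ofReal (4 ^ L) * I * decayFun L 0 x := by
      intro x hx
      have h1 : ENNReal.ofReal (4 ^ L) * I * decayFun L 0 x =
          ∫⁻ y, ENNReal.ofReal (4 ^ L) * decayFun L 0 x * (decayFun L 0 y * g y) := by
        rw [lintegral_const_mul _ (by have := measurable_decayFun (d := d) L 0; fun_prop), ← hI]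
        ring
      rw [h1, ← lintegral_add_left (by
        have := hg.indicator (measurableSet_nearShells d n)
        fun_prop)]
      refine lintegral_mono fun y => ?_
      by_cases hy : y ∈ nearShells d n
      · simp only [Set.indicator_of_mem hy]
        exact le_self_add
      · simp only [Set.indicator_of_notMem hy, mul_zero, zero_add]
        calc κ (x - y) * g y ≤
            ENNReal.ofReal (4 ^ L) * (decayFun L 0 x * decayFun L 0 y) * g y := by
              gcongr; exact decay_sub_le_of_notMem_nearShells hx hy L
          _ = _ := by ring
    refine (herzShellNorm_mono hp hpt).trans ((herzShellNorm_add_le hp hm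
      ((measurable_decayFun L 0).const_mul _) n).trans (add_le_add ?_ ?_))
    · rw [hK]
      exact herzShellNorm_nearShells_le hp hκm hg n
    · rw [herzShellNorm_const_mul hp (measurable_decayFun L 0)]
  refine (seqNorm_mono hq hbound).trans ((seqNorm_add_le hq _ _).trans ?_)
  rw [seqNorm_const_mul hq, seqNorm_const_mul hq]
  push_cast
  rw [add_mul]
  refine add_le_add ?_ ?_
  · rw [mul_assoc _ 4]
    refine mul_le_mul' le_rfl ((seqNorm_add_le hq _ _).trans
      ((add_le_add (seqNorm_add_le hq _ _) (seqNorm_comp_succ_le hq _)).trans ?_))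
    refine (add_le_add (add_le_add (seqNorm_comp_pred_le hq _) le_rfl) le_rfl).trans (le_of_eq ?_)
    rw [herzLNorm]
    ring
  · have h := hC₁ 0
    simp only [Nat.cast_zero, zero_mul, Real.rpow_zero, ENNReal.ofReal_one, mul_one] at h
    calc _ ≤ ENNReal.ofReal (4 ^ L) * (C₂ * herzLNorm α p q g) * C₁ := by
          gcongr
          exacts [hC₂ g hg, h]
      _ = _ := by rw [ENNReal.ofReal]; ring

/-! ## Completeness of the Herz space -/

/-- **Fatou's lemma** for the Herz norm. -/
theorem herzLNorm_le_of_tendsto_ae {d : ℕ} {α p q : ℝ} (hp : 1 ≤ p) (hq : 1 ≤ q)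
    {F : ℕ → 𝔼 d → ℝ≥0∞} {f : 𝔼 d → ℝ≥0∞} (hF : ∀ n, AEMeasurable (F n) volume)
    (hlim : ∀ᵐ x, Tendsto (fun n => F n x) atTop (𝓝 (f x))) {c : ℝ≥0∞}
    (hc : ∀ᶠ n in atTop, herzLNorm α p q (F n) ≤ c) : herzLNorm α p q f ≤ c := by
  have h0 : 0 < p := by linarith
  have hq0 : 0 < q := by linarith
  -- Continuous increasing maps commute with lower limits, so Fatou can be used first for the
  -- integral over each shell and then for the sum over shells.
  have hφ : ∀ (n : ℕ) (u : ℕ → ℝ≥0∞),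
      (ENNReal.ofReal (2 ^ (n * α)) * (liminf u atTop) ^ (1 / p)) ^ q =
        liminf (fun k => (ENNReal.ofReal (2 ^ (n * α)) * (u k) ^ (1 / p)) ^ q) atTop := by
    intro n u
    refine Monotone.map_liminf_of_continuousAt
      (f := fun a : ℝ≥0∞ => (ENNReal.ofReal (2 ^ (n * α)) * a ^ (1 / p)) ^ q)
      (fun a b hab => by dsimp only; gcongr) u (Continuous.continuousAt ?_)
    exact (ENNReal.continuous_rpow_const).comp
      ((ENNReal.continuous_const_mul ENNReal.ofReal_ne_top).comp ENNReal.continuous_rpow_const)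
  have hshell : ∀ n, herzShellNorm α p f n ^ q ≤
      liminf (fun k => herzShellNorm α p (F k) n ^ q) atTop := by
    intro n
    simp only [herzShellNorm]
    rw [← hφ]
    gcongr
    refine le_trans (le_of_eq ?_) (lintegral_liminf_le' fun k => ((hF k).restrict.pow_const p))
    refine lintegral_congr_ae (ae_restrict_of_ae ?_)
    filter_upwards [hlim] with x hx
    exact ((ENNReal.continuous_rpow_const.tendsto _).comp hx).liminf_eq.symm
  have hsum : ∑' n, herzShellNorm α p f n ^ q ≤ c ^ q := by
    calc ∑' n, herzShellNorm α p f n ^ q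
        ≤ ∑' n, liminf (fun k => herzShellNorm α p (F k) n ^ q) atTop :=
          ENNReal.tsum_le_tsum hshell
      _ ≤ liminf (fun k => ∑' n, herzShellNorm α p (F k) n ^ q) atTop := by
          simp only [← lintegral_count]
          exact lintegral_liminf_le fun k => measurable_of_countable _
      _ ≤ c ^ q := by
          refine liminf_le_of_frequently_le' (Eventually.frequently ?_)
          filter_upwards [hc] with k hk
          calc ∑' n, herzShellNorm α p (F k) n ^ q = herzLNorm α p q (F k) ^ q := by
                rw [herzLNorm, seqNorm, ← ENNReal.rpow_mul, one_div_mul_cancel hq0.ne',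
                  ENNReal.rpow_one]
            _ ≤ _ := by gcongr
  calc herzLNorm α p q f ≤ (c ^ q) ^ (1 / q) := by
        unfold herzLNorm seqNorm; gcongr
    _ = c := by rw [← ENNReal.rpow_mul, mul_one_div_cancel hq0.ne', ENNReal.rpow_one]

namespace HerzSpace

variable {d : ℕ} {α p q : ℝ} [hp : Fact (1 ≤ p)] [hq : Fact (1 ≤ q)]

/-- The element of the Herz space defined by a measurable function of finite Herz norm. -/
noncomputable def mk (f : 𝔼 d → ℂ) (hf : AEStronglyMeasurable f volume) (h : herzENorm α p q f < ∞) :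
    HerzSpace d α p q :=
  ⟨AEEqFun.mk f hf, by
    show herzENorm α p q _ < ∞
    rwa [herzENorm_congr_ae (AEEqFun.coeFn_mk f hf)]⟩

/-- The representative of an element of the Herz space. -/
noncomputable def fn (F : HerzSpace d α p q) : 𝔼 d → ℂ := F

theorem coeFn_mk (f : 𝔼 d → ℂ) (hf : AEStronglyMeasurable f volume)
    (h : herzENorm α p q f < ∞) : (mk f hf h : HerzSpace d α p q).fn =ᵐ[volume] f :=
  AEEqFun.coeFn_mk f hf

theorem ext_ae {F G : HerzSpace d α p q} (h : F.fn =ᵐ[volume] G.fn) : F = G :=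
  Subtype.ext (AEEqFun.ext h)

theorem measurable_fn (F : HerzSpace d α p q) : Measurable F.fn :=
  F.1.measurable

theorem aestronglyMeasurable (F : HerzSpace d α p q) :
    AEStronglyMeasurable F.fn volume :=
  F.1.aestronglyMeasurable

theorem coeFn_add (F G : HerzSpace d α p q) :
    (F + G).fn =ᵐ[volume] fun x => F.fn x + G.fn x :=
  AEEqFun.coeFn_add F.1 G.1

theorem coeFn_sub (F G : HerzSpace d α p q) :
    (F - G).fn =ᵐ[volume] fun x => F.fn x - G.fn x :=
  AEEqFun.coeFn_sub F.1 G.1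

theorem coeFn_smul (c : ℂ) (F : HerzSpace d α p q) :
    (c • F).fn =ᵐ[volume] fun x => c * F.fn x :=
  AEEqFun.coeFn_smul c F.1

theorem coeFn_zero : (0 : HerzSpace d α p q).fn =ᵐ[volume] fun _ => 0 :=
  AEEqFun.coeFn_zero

theorem herzENorm_lt_top (F : HerzSpace d α p q) : herzENorm α p q F.fn < ∞ := F.2

theorem enorm_eq (F : HerzSpace d α p q) : ‖F‖ₑ = herzENorm α p q F.fn := by
  rw [← ofReal_norm]
  exact ENNReal.ofReal_toReal F.2.ne

theorem enorm_eq_of_ae {F : HerzSpace d α p q} {f : 𝔼 d → ℂ} (h : F.fn =ᵐ[volume] f) :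
    ‖F‖ₑ = herzENorm α p q f := by
  rw [enorm_eq, herzENorm_congr_ae h]

/-- The Riesz–Fischer argument: the weighted L¹ bound makes an absolutely convergent series converge
almost everywhere, its weight being positive everywhere, and Fatou bounds the distance from the sum
to a partial sum by twice the tail of the norms. Completeness is needed to extend operators from
Schwartz functions. -/
instance : CompleteSpace (HerzSpace d α p q) := by
  refine NormedAddCommGroup.completeSpace_of_summable_imp_tendsto fun u hu => ?_
  have hp1 := hp.out
  have hq1 := hq.out
  have hsum : ∑' k, ‖u k‖ₑ ≠ ∞ := by
    simp only [← ofReal_norm]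
    exact hu.tsum_ofReal_ne_top
  obtain ⟨C, hC⟩ := lintegral_decayFun_mul_le (d := d) (α := α) hp1 hq1
  have hfin : ∀ᵐ x, ∑' k, ‖(u k).fn x‖ₑ < ∞ := by
    have hmeas : ∀ k, Measurable fun x => ‖(u k).fn x‖ₑ := fun k => (u k).measurable_fn.enorm
    have h1 : ∫⁻ y, decayFun (herzDecay d α) 0 y * ∑' k, ‖(u k).fn y‖ₑ ≠ ∞ := by
      simp only [← ENNReal.tsum_mul_left]
      rw [lintegral_tsum fun k => by
        have := measurable_decayFun (d := d) (herzDecay d α) 0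
        exact (this.mul (hmeas k)).aemeasurable]
      refine ne_top_of_le_ne_top (ENNReal.mul_ne_top (ENNReal.coe_ne_top (r := C)) hsum) ?_
      rw [← ENNReal.tsum_mul_left]
      refine ENNReal.tsum_le_tsum fun k => (hC _ (hmeas k)).trans ?_
      rw [enorm_eq]
      gcongr
      exact herzLNorm_le_herzENorm hp1 hq1 _
    have h2 := ae_lt_top ((measurable_decayFun _ _).mul (Measurable.tsum hmeas)) h1
    filter_upwards [h2] with x hx
    refine lt_top_iff_ne_top.mpr fun htop => ?_
    simp only [Pi.mul_apply, htop] at hx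
    rw [ENNReal.mul_top] at hx
    · exact lt_irrefl _ hx
    · simp only [decayFun, ne_eq, ENNReal.ofReal_eq_zero, not_le]
      positivity
  set S : ℕ → HerzSpace d α p q := fun n => ∑ i ∈ Finset.range n, u i with hS
  have hScoe : ∀ n, (S n).fn =ᵐ[volume] fun x => ∑ i ∈ Finset.range n, (u i).fn x := by
    intro n
    induction n with
    | zero => simpa [hS] using (coeFn_zero (d := d) (α := α) (p := p) (q := q))
    | succ n ih =>
      have h : S (n + 1) = S n + u n := Finset.sum_range_succ _ _
      rw [h]
      filter_upwards [ih, coeFn_add (S n) (u n)] with x h1 h2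
      rw [h2, h1, Finset.sum_range_succ]
  have hlim : ∀ᵐ x, Tendsto (fun n => (S n).fn x) atTop (𝓝 (∑' k, (u k).fn x)) := by
    filter_upwards [hfin, ae_all_iff.mpr hScoe] with x h1 h2
    simp only [h2]
    refine (Summable.of_norm ?_).hasSum.tendsto_sum_nat
    refine (ENNReal.tsum_coe_ne_top_iff_summable_coe (f := fun k => ‖(u k).fn x‖₊)).mp ?_
    exact h1.ne
  set f : 𝔼 d → ℂ := fun x => ∑' k, (u k).fn x with hf
  have hfm : AEStronglyMeasurable f volume :=
    aestronglyMeasurable_of_tendsto_ae atTop (fun n => (S n).aestronglyMeasurable) hlim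
  have hSdist : ∀ m n, m ≤ n → ‖S n - S m‖ₑ ≤ ∑' k, ‖u (k + m)‖ₑ := by
    intro m n hmn
    have h : S n - S m = ∑ i ∈ Finset.range (n - m), u (i + m) := by
      simp only [hS]
      rw [← Finset.sum_Ico_eq_sub _ hmn, Finset.sum_Ico_eq_sum_range]
      simp only [add_comm]
    rw [h]
    refine (enorm_sum_le _ _).trans ?_
    exact ENNReal.sum_le_tsum _
  have hbound : ∀ m, herzENorm α p q (fun x => f x - (S m).fn x) ≤ 2 * ∑' k, ‖u (k + m)‖ₑ := by
    intro m
    refine (herzENorm_le_two_mul hp1 hq1 _).trans ?_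
    gcongr
    refine herzLNorm_le_of_tendsto_ae hp1 hq1 (F := fun n x => ‖(S n).fn x - (S m).fn x‖ₑ)
      (fun n => ((S n).measurable_fn.sub (S m).measurable_fn).enorm.aemeasurable) ?_ ?_
    · filter_upwards [hlim] with x hx
      exact (hx.sub_const _).enorm
    · filter_upwards [eventually_ge_atTop m] with n hn
      refine le_trans ?_ (hSdist m n hn)
      rw [enorm_eq_of_ae (coeFn_sub (S n) (S m))]
      exact herzLNorm_le_herzENorm hp1 hq1 _
  have hffin : herzENorm α p q f < ∞ := by
    have h := hbound 0
    have h1 : herzENorm α p q f = herzENorm α p q (fun x => f x - (S 0).fn x) := by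
      refine herzENorm_congr_ae ?_
      filter_upwards [hScoe 0] with x hx
      simp [hx]
    rw [h1]
    exact lt_of_le_of_lt h (ENNReal.mul_lt_top (by simp) (lt_top_iff_ne_top.mpr hsum))
  refine ⟨mk f hfm hffin, ?_⟩
  rw [tendsto_iff_edist_tendsto_0]
  have htail : Tendsto (fun m => 2 * ∑' k, ‖u (k + m)‖ₑ) atTop (𝓝 0) := by
    simpa using ENNReal.Tendsto.const_mul (ENNReal.tendsto_sum_nat_add _ hsum)
      (Or.inr (ENNReal.ofNat_ne_top (n := 2)))
  refine tendsto_of_tendsto_of_tendsto_of_le_of_le tendsto_const_nhds htail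
    (fun _ => zero_le) fun m => ?_
  dsimp only
  rw [edist_comm, edist_eq_enorm_sub, enorm_eq_of_ae (f := fun x => f x - (S m).fn x)]
  · exact hbound m
  · filter_upwards [coeFn_sub (mk f hfm hffin) (S m),
      coeFn_mk (α := α) (p := p) (q := q) f hfm hffin] with x h1 h2
    rw [h1, h2]

end HerzSpace

/-! ## Approximation by Schwartz functions -/

theorem seqNorm_tail_tendsto_zero {q : ℝ} (hq : 1 ≤ q) {a : ℕ → ℝ≥0∞} (h : seqNorm q a < ∞) :
    Tendsto (fun N => seqNorm q (fun n => if n ≤ N then 0 else a n)) atTop (𝓝 0) := by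
  have h0 : 0 < q := by linarith
  have hfin : ∑' n, a n ^ q ≠ ∞ := fun htop => by
    rw [seqNorm, htop, ENNReal.top_rpow_of_pos (by positivity)] at h
    exact lt_irrefl _ h
  have heq : ∀ N, seqNorm q (fun n => if n ≤ N then 0 else a n) =
      (∑' k, a (k + (N + 1)) ^ q) ^ (1 / q) := fun N => by
    unfold seqNorm
    rw [← Summable.sum_add_tsum_nat_add' (f := fun n => (if n ≤ N then 0 else a n) ^ q)
      (k := N + 1) ENNReal.summable, Finset.sum_eq_zero, zero_add]
    · congr 2
      ext k
      rw [if_neg (by omega)]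
    · intro n hn
      rw [if_pos (by simpa [Nat.lt_succ_iff] using hn), ENNReal.zero_rpow_of_pos h0]
  simp only [heq]
  have h1 := ((ENNReal.tendsto_sum_nat_add _ hfin).comp (tendsto_add_atTop_nat 1))
  have h2 := (ENNReal.continuous_rpow_const (y := 1 / q)).tendsto 0
  rw [ENNReal.zero_rpow_of_pos (by positivity)] at h2
  exact h2.comp h1

/-- The restriction of a function to the ball of radius `2^N`. -/
noncomputable def ballTruncation {d : ℕ} (N : ℕ) (f : 𝔼 d → ℂ) : 𝔼 d → ℂ :=
  (Metric.closedBall (0 : 𝔼 d) (2 ^ N)).indicator f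

theorem tendsto_herzLNorm_sub_ballTruncation {d : ℕ} {α p q : ℝ} (hp : 1 ≤ p) (hq : 1 ≤ q)
    {f : 𝔼 d → ℂ} (h : herzLNorm α p q (fun x => ‖f x‖ₑ) < ∞) :
    Tendsto (fun N => herzLNorm α p q (fun x => ‖f x - ballTruncation N f x‖ₑ)) atTop (𝓝 0) := by
  have h0 : 0 < p := by linarith
  refine tendsto_of_tendsto_of_tendsto_of_le_of_le tendsto_const_nhds
    (seqNorm_tail_tendsto_zero hq h) (fun _ => zero_le) fun N => ?_
  refine seqNorm_mono hq fun n => ?_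
  split_ifs with hn
  · have h1 : herzShellNorm (d := d) α p (fun _ => 0) n = 0 := by
      simp [herzShellNorm, h0]
    rw [← h1]
    refine herzShellNorm_mono hp fun x hx => ?_
    have hx' : x ∈ Metric.closedBall (0 : 𝔼 d) (2 ^ N) := by
      simpa using (norm_le_of_mem_herzShell hx).trans (pow_le_pow_right₀ one_le_two hn)
    simp [ballTruncation, hx']
  · refine herzShellNorm_mono hp fun x _ => ?_
    by_cases hx : x ∈ Metric.closedBall (0 : 𝔼 d) (2 ^ N) <;> simp [ballTruncation, hx]

/-- Taking α = 0 and q = p gives back L^p, so statements proved for Herz norms also serve for L². -/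
theorem herzLNorm_zero_self {d : ℕ} {p : ℝ} (hp : 1 ≤ p) (f : 𝔼 d → ℝ≥0∞) :
    herzLNorm 0 p p f = (∫⁻ x, f x ^ p) ^ (1 / p) := by
  have h0 : 0 < p := by linarith
  rw [lintegral_eq_tsum_herzShell]
  simp [herzLNorm, seqNorm, herzShellNorm, ← ENNReal.rpow_mul, h0.ne']

theorem herzLNorm_zero_two {d : ℕ} (f : 𝔼 d → ℂ) :
    herzLNorm 0 2 2 (fun x => ‖f x‖ₑ) = eLpNorm f 2 volume := by
  rw [herzLNorm_zero_self one_le_two, eLpNorm_eq_lintegral_rpow_enorm_toReal two_ne_zero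
    ENNReal.ofNat_ne_top]
  simp

theorem memLp_ballTruncation {d : ℕ} {α p q : ℝ} (hp : 1 ≤ p) (hq : 1 ≤ q) {f : 𝔼 d → ℂ}
    (hf : AEStronglyMeasurable f volume) (h : herzENorm α p q f < ∞) (N : ℕ) :
    MemLp (ballTruncation N f) (ENNReal.ofReal p) volume := by
  have h0 : 0 < p := by linarith
  refine ⟨hf.indicator measurableSet_closedBall, ?_⟩
  unfold ballTruncation
  rw [eLpNorm_indicator_eq_lintegral hp measurableSet_closedBall]
  refine ENNReal.rpow_lt_top_of_nonneg (by positivity) (ne_of_lt ?_)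
  have hsub : Metric.closedBall (0 : 𝔼 d) (2 ^ N) ⊆
      ⋃ n ∈ Finset.range (N + 1), herzShell d n := fun x hx => by
    obtain ⟨n, hn⟩ := exists_mem_herzShell x
    refine Set.mem_biUnion (Finset.mem_coe.mpr (Finset.mem_range.mpr ?_)) hn
    by_contra hlt
    have h1 := lt_norm_of_mem_herzShell hn (show N < n by omega)
    rw [mem_closedBall_zero_iff] at hx
    linarith
  refine (lintegral_mono_set hsub).trans_lt ?_
  rw [lintegral_biUnion_finset (fun a _ b _ hab => disjoint_herzShell d hab)
    fun n _ => measurableSet_herzShell d n]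
  refine ENNReal.sum_lt_top.mpr fun n _ => ?_
  have h1 : herzShellNorm α p (fun x => ‖f x‖ₑ) n < ∞ :=
    ((le_seqNorm hq _ n).trans (herzLNorm_le_herzENorm hp hq f)).trans_lt h
  by_contra htop
  rw [herzShellNorm, not_lt_top_iff.mp htop, ENNReal.top_rpow_of_pos (by positivity),
    ENNReal.mul_top (by simpa using by positivity)] at h1
  exact lt_irrefl _ h1

/-- A smooth L^r approximant is multiplied by a bump χ equal to 1 on the ball of radius 2^N. As the
truncation is unchanged by χ, the error is merely multiplied by χ ≤ 1, and it acquires a support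
that does not depend on ε. -/
theorem exists_schwartz_eLpNorm_sub_le {d : ℕ} {r : ℝ} (hr : 1 ≤ r) (N : ℕ) {f : 𝔼 d → ℂ}
    (hf : MemLp (ballTruncation N f) (ENNReal.ofReal r) volume) {ε : ℝ} (hε : 0 < ε) :
    ∃ g : 𝓢(𝔼 d, ℂ),
      (Function.support (ballTruncation N f - ⇑g) ⊆ Metric.closedBall (0 : 𝔼 d) (2 ^ (N + 1))) ∧
      eLpNorm (ballTruncation N f - ⇑g) (ENNReal.ofReal r) volume ≤ ENNReal.ofReal ε := by
  obtain ⟨g, hg1, hg2, hg3⟩ := hf.exist_eLpNorm_sub_le ENNReal.ofReal_ne_top (by simpa using hr) hε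
  let χ : ContDiffBump (0 : 𝔼 d) := ⟨2 ^ N, 2 ^ (N + 1), by positivity, by gcongr <;> simp⟩
  have hcs : HasCompactSupport fun x => (χ x : ℂ) * g x := hg1.mul_left
  have hcd : ContDiff ℝ (⊤ : ℕ∞) fun x => (χ x : ℂ) * g x :=
    (Complex.ofRealCLM.contDiff.comp χ.contDiff).mul hg2
  have hsupp : ∀ x, ballTruncation N f x - χ x * g x = χ x * (ballTruncation N f x - g x) := by
    intro x
    by_cases hx : x ∈ Metric.closedBall (0 : 𝔼 d) (2 ^ N)
    · have : χ x = 1 := χ.one_of_mem_closedBall hx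
      simp [this]
    · simp [ballTruncation, hx]
  refine ⟨hcs.toSchwartzMap hcd, ?_, ?_⟩
  · intro x hx
    by_contra hx2
    refine hx ?_
    have h1 : χ x = 0 := by
      refine χ.zero_of_le_dist ?_
      simp only [Metric.mem_closedBall, not_le] at hx2
      exact hx2.le
    have := hsupp x
    simpa [h1] using this
  · refine le_trans (eLpNorm_mono fun x => ?_) hg3
    have h2 : ‖(χ x : ℂ)‖ ≤ 1 := by
      rw [Complex.norm_real, Real.norm_of_nonneg χ.nonneg]
      exact χ.le_one
    calc ‖(ballTruncation N f - ⇑(hcs.toSchwartzMap hcd)) x‖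
        = ‖(χ x : ℂ) * (ballTruncation N f x - g x)‖ := by rw [← hsupp]; rfl
      _ ≤ _ := by
          rw [norm_mul]
          exact mul_le_of_le_one_left (norm_nonneg _) h2

theorem eLpNorm_le_of_support_subset_ball {d : ℕ} {s r : ℝ} (hs : 1 ≤ s) (hsr : s ≤ r) (N : ℕ) :
    ∃ C : ℝ≥0, ∀ h : 𝔼 d → ℂ, AEStronglyMeasurable h volume →
      Function.support h ⊆ Metric.closedBall (0 : 𝔼 d) (2 ^ N) →
      eLpNorm h (ENNReal.ofReal s) volume ≤ C * eLpNorm h (ENNReal.ofReal r) volume := by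
  have hfin : volume (Metric.closedBall (0 : 𝔼 d) (2 ^ N)) ^ (1 / s - 1 / r) ≠ ∞ :=
    ENNReal.rpow_ne_top_of_nonneg
      (sub_nonneg.mpr (one_div_le_one_div_of_le (by linarith) hsr)) measure_closedBall_lt_top.ne
  refine ⟨(volume (Metric.closedBall (0 : 𝔼 d) (2 ^ N)) ^ (1 / s - 1 / r)).toNNReal,
    fun h hm hsupp => ?_⟩
  · have h1 := eLpNorm_le_eLpNorm_mul_rpow_measure_univ
      (μ := volume.restrict (Metric.closedBall (0 : 𝔼 d) (2 ^ N)))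
      (ENNReal.ofReal_le_ofReal hsr) hm.restrict
    rw [eLpNorm_restrict_eq_of_support_subset hsupp, eLpNorm_restrict_eq_of_support_subset hsupp,
      Measure.restrict_apply_univ, ENNReal.toReal_ofReal (by linarith),
      ENNReal.toReal_ofReal (by linarith), mul_comm, ← ENNReal.coe_toNNReal hfin] at h1
    exact h1

theorem herzENorm_le_of_support_subset_ball {d : ℕ} {α p q : ℝ} (hp : 1 ≤ p) (hq : 1 ≤ q)
    (N : ℕ) : ∃ C : ℝ≥0, ∀ h : 𝔼 d → ℂ,
      Function.support h ⊆ Metric.closedBall (0 : 𝔼 d) (2 ^ N) →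
      herzENorm α p q h ≤ C * eLpNorm h (ENNReal.ofReal p) volume := by
  have h0 : 0 < p := by linarith
  refine ⟨2 * ∑ n ∈ Finset.range (N + 1), ((2 : ℝ) ^ (n * α)).toNNReal, fun h hsupp => ?_⟩
  refine (herzENorm_le_two_mul hp hq h).trans ?_
  push_cast
  rw [mul_assoc]
  gcongr
  refine (seqNorm_le_tsum hq _).trans ?_
  rw [tsum_eq_sum (s := Finset.range (N + 1)), Finset.sum_mul]
  · refine Finset.sum_le_sum fun n _ => ?_
    rw [herzShellNorm_enorm hp]
    exact mul_le_mul' le_rfl (eLpNorm_indicator_le h)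
  · intro n hn
    rw [herzShellNorm_enorm hp]
    have h1 : (herzShell d n).indicator h = 0 := by
      ext x
      by_cases hx : x ∈ herzShell d n
      · rw [Set.indicator_of_mem hx]
        by_contra hne
        have h2 := hsupp hne
        have h3 := lt_norm_of_mem_herzShell hx (show N < n by simpa using hn)
        rw [mem_closedBall_zero_iff] at h2
        linarith
      · rw [Set.indicator_of_notMem hx]; rfl
    rw [h1, eLpNorm_zero, mul_zero]

/-- On a fixed ball the Herz norm is controlled by L^p, and both L^p and L^s by L^r. One approximant
in L^r therefore serves both estimates. -/
theorem exists_schwartz_approx_ballTruncation {d : ℕ} {α p q r s : ℝ} (hp : 1 ≤ p) (hq : 1 ≤ q)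
    (hpr : p ≤ r) (hs : 1 ≤ s) (hsr : s ≤ r) (N : ℕ) {f : 𝔼 d → ℂ}
    (hf : MemLp (ballTruncation N f) (ENNReal.ofReal r) volume) {ε : ℝ≥0∞} (hε : ε ≠ 0) :
    ∃ g : 𝓢(𝔼 d, ℂ), herzENorm α p q (ballTruncation N f - ⇑g) ≤ ε ∧
      eLpNorm (ballTruncation N f - ⇑g) (ENNReal.ofReal s) volume ≤ ε := by
  obtain ⟨C₁, hC₁⟩ := herzENorm_le_of_support_subset_ball (d := d) (α := α) hp hq (N + 1)
  obtain ⟨C₂, hC₂⟩ := eLpNorm_le_of_support_subset_ball (d := d) hp hpr (N + 1)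
  obtain ⟨C₃, hC₃⟩ := eLpNorm_le_of_support_subset_ball (d := d) hs hsr (N + 1)
  obtain ⟨η, hη0, hη⟩ : ∃ η : ℝ, 0 < η ∧ ((C₁ * C₂ + C₃ : ℝ≥0) : ℝ≥0∞) * ENNReal.ofReal η ≤ ε := by
    by_cases htop : ε = ∞
    · exact ⟨1, one_pos, by simp [htop]⟩
    · have hε' : 0 < ε.toReal := ENNReal.toReal_pos hε htop
      refine ⟨ε.toReal / (C₁ * C₂ + C₃ + 1), by positivity, ?_⟩
      rw [← ENNReal.ofReal_coe_nnreal, ← ENNReal.ofReal_mul (by positivity)]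
      refine ENNReal.ofReal_le_of_le_toReal ?_
      rw [mul_div_assoc', div_le_iff₀ (by positivity)]
      push_cast
      nlinarith
  obtain ⟨g, hg1, hg2⟩ := exists_schwartz_eLpNorm_sub_le (hp.trans hpr) N hf hη0
  have hm : AEStronglyMeasurable (ballTruncation N f - ⇑g) volume :=
    hf.1.sub g.continuous.aestronglyMeasurable
  have hle : ((C₁ * C₂ : ℝ≥0) : ℝ≥0∞) * ENNReal.ofReal η ≤ ε := le_trans (by gcongr; simp) hη
  have hle' : (C₃ : ℝ≥0∞) * ENNReal.ofReal η ≤ ε := le_trans (by gcongr; simp) hη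
  refine ⟨g, ?_, ?_⟩
  · refine (hC₁ _ hg1).trans (le_trans ?_ hle)
    push_cast
    rw [mul_assoc]
    gcongr
    exact (hC₂ _ hm hg1).trans (by gcongr)
  · exact (hC₃ _ hm hg1).trans (le_trans (by gcongr) hle')

/-- Schwartz functions are dense in the Herz space, and in its intersection with `L^2`. -/
theorem exists_schwartz_approx {d : ℕ} {α p q : ℝ} (hp : 1 ≤ p) (hq : 1 ≤ q) {f : 𝔼 d → ℂ}
    (hf : AEStronglyMeasurable f volume) (h : herzENorm α p q f < ∞) {ε : ℝ≥0∞} (hε : ε ≠ 0) :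
    ∃ g : 𝓢(𝔼 d, ℂ), herzENorm α p q (fun x => f x - g x) ≤ ε ∧
      (MemLp f 2 volume → eLpNorm (fun x => f x - g x) 2 volume ≤ ε) := by
  have hε2 : ε / 2 ≠ 0 := by simpa using hε
  have hε4 : ε / 2 / 2 ≠ 0 := by simpa using hε
  have hH := (herzLNorm_le_herzENorm hp hq f).trans_lt h
  have h1 : ∀ᶠ N in atTop, herzENorm α p q (f - ballTruncation N f) ≤ ε / 2 := by
    filter_upwards [(tendsto_herzLNorm_sub_ballTruncation hp hq hH).eventually_le_const
      (pos_iff_ne_zero.mpr hε4)] with N hN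
    refine (herzENorm_le_two_mul hp hq _).trans ?_
    calc 2 * herzLNorm α p q (fun x => ‖(f - ballTruncation N f) x‖ₑ) ≤ 2 * (ε / 2 / 2) :=
          mul_le_mul' le_rfl hN
      _ = ε / 2 := ENNReal.mul_div_cancel two_ne_zero ENNReal.ofNat_ne_top
  have hBm : ∀ N, AEStronglyMeasurable (ballTruncation N f) volume := fun N =>
    hf.indicator measurableSet_closedBall
  have hsplit : ∀ N (g : 𝓢(𝔼 d, ℂ)), (fun x => f x - g x) =
      (f - ballTruncation N f) + (ballTruncation N f - ⇑g) := fun N g => by ext x; simp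
  have hherz : ∀ N (g : 𝓢(𝔼 d, ℂ)), herzENorm α p q (f - ballTruncation N f) ≤ ε / 2 →
      herzENorm α p q (ballTruncation N f - ⇑g) ≤ ε / 2 →
      herzENorm α p q (fun x => f x - g x) ≤ ε := fun N g hN hg => by
    rw [hsplit N g, ← ENNReal.add_halves ε]
    exact (herzENorm_add_le hp hq (hf.sub (hBm N))
      ((hBm N).sub g.continuous.aestronglyMeasurable)).trans (add_le_add hN hg)
  have hpt := fun N => memLp_ballTruncation hp hq hf h N
  by_cases hf2 : MemLp f 2 volume
  · have h2 : ∀ᶠ N in atTop, eLpNorm (f - ballTruncation N f) 2 volume ≤ ε / 2 := by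
      have hlt : herzLNorm 0 2 2 (fun x => ‖f x‖ₑ) < ∞ := by
        rw [herzLNorm_zero_two]; exact hf2.2
      filter_upwards [(tendsto_herzLNorm_sub_ballTruncation one_le_two one_le_two
        hlt).eventually_le_const (pos_iff_ne_zero.mpr hε2)] with N hN
      rwa [herzLNorm_zero_two] at hN
    obtain ⟨N, hN1, hN2⟩ := (h1.and h2).exists
    -- The truncation lies in both L^p and L², hence in the larger of the two exponents, which
    -- dominates both on a ball.
    have hmem : MemLp (ballTruncation N f) (ENNReal.ofReal (max p 2)) volume := by
      rcases max_choice p 2 with h3 | h3 <;> rw [h3]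
      · exact hpt N
      · rw [ENNReal.ofReal_ofNat]
        exact hf2.indicator measurableSet_closedBall
    obtain ⟨g, hg1, hg2⟩ := exists_schwartz_approx_ballTruncation (α := α) hp hq (le_max_left p 2)
      one_le_two (le_max_right p 2) N hmem hε2
    refine ⟨g, hherz N g hN1 hg1, fun _ => ?_⟩
    rw [ENNReal.ofReal_ofNat] at hg2
    rw [hsplit N g, ← ENNReal.add_halves ε]
    exact (eLpNorm_add_le (hf.sub (hBm N)) ((hBm N).sub g.continuous.aestronglyMeasurable)
      one_le_two).trans (add_le_add hN2 hg2)
  · obtain ⟨N, hN⟩ := h1.exists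
    obtain ⟨g, hg1, -⟩ := exists_schwartz_approx_ballTruncation (α := α) hp hq le_rfl
      hp le_rfl N (hpt N) hε2
    exact ⟨g, hherz N g hN hg1, fun h3 => absurd h3 hf2⟩

/-! ## Fourier multipliers -/

/-- The Fourier multiplier operator with symbol `b`, in the normalization `e^{2πi x·w}`. -/
noncomputable def fourierMultiplier {d : ℕ} (b f : 𝔼 d → ℂ) : 𝔼 d → ℂ :=
  𝓕⁻ fun w => b w * 𝓕 f w

theorem integral_fourierInv_mul_eq {d : ℕ} {f g : 𝔼 d → ℂ} (hf : Integrable f) (hg : Integrable g) :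
    ∫ x, 𝓕⁻ f x * g x = ∫ x, f x * 𝓕⁻ g x := by
  have h := VectorFourier.integral_fourierIntegral_smul_eq_flip (L := -innerₗ (𝔼 d))
    (μ := volume) (ν := volume) Real.continuous_fourierChar (by
      simp only [LinearMap.neg_apply, innerₗ_apply_apply]
      fun_prop) hf hg
  have hflip : (-innerₗ (𝔼 d)).flip = -innerₗ (𝔼 d) :=
    LinearMap.ext₂ fun x y => by simp [real_inner_comm]
  rw [hflip] at h
  simpa using! h

theorem integral_fourier_mul_eq {d : ℕ} {f g : 𝔼 d → ℂ} (hf : Integrable f) (hg : Integrable g) :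
    ∫ x, 𝓕 f x * g x = ∫ x, f x * 𝓕 g x := by
  have h := VectorFourier.integral_fourierIntegral_smul_eq_flip (L := innerₗ (𝔼 d))
    (μ := volume) (ν := volume) Real.continuous_fourierChar continuous_inner hf hg
  simpa using! h

theorem continuous_fourierInv {d : ℕ} {f : 𝔼 d → ℂ} (hf : Integrable f) : Continuous (𝓕⁻ f) :=
  VectorFourier.fourierIntegral_continuous Real.continuous_fourierChar (L := -innerₗ (𝔼 d)) (by
      simp only [LinearMap.neg_apply, innerₗ_apply_apply]
      fun_prop) hf

/-- The Fourier multiplier operator is convolution with the inverse Fourier transform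
of the symbol. -/
theorem fourierMultiplier_eq_convolution {d : ℕ} {b f : 𝔼 d → ℂ} (hb : Integrable b)
    (hf : Integrable f) (x : 𝔼 d) : fourierMultiplier b f x = ∫ y, 𝓕⁻ b (x - y) * f y := by
  -- The modulated symbol c has Fourier transform y ↦ 𝓕⁻ b (x - y); moving the transform from c to f
  -- gives the claim.
  set c : 𝔼 d → ℂ := fun w => Complex.exp ((2 * Real.pi * inner ℝ w x : ℝ) * Complex.I) * b w
    with hc
  have hcint : Integrable c := by
    refine hb.bdd_mul (c := 1) (by fun_prop) (Filter.Eventually.of_forall fun w => ?_)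
    rw [Complex.norm_exp_ofReal_mul_I]
  have h1 : ∀ y, 𝓕 c y = 𝓕⁻ b (x - y) := fun y => by
    rw [Real.fourier_eq', Real.fourierInv_eq']
    refine integral_congr_ae (Filter.Eventually.of_forall fun w => ?_)
    simp only [hc, smul_eq_mul]
    rw [← mul_assoc, ← Complex.exp_add, ← add_mul, ← Complex.ofReal_add, inner_sub_right]
    congr 4
    ring
  have h2 := integral_fourier_mul_eq hcint hf
  simp only [h1] at h2
  rw [h2, fourierMultiplier, Real.fourierInv_eq']
  refine integral_congr_ae (Filter.Eventually.of_forall fun w => ?_)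
  simp only [hc, smul_eq_mul]
  ring

/-- Tested against smooth compactly supported functions, the L² transform (as a tempered
distribution) and the integral formula both move the transform onto the test function. -/
theorem fourierInv_toLp_ae_eq {d : ℕ} {g : 𝔼 d → ℂ} (h1 : Integrable g)
    (h2 : MemLp g 2 volume) :
    ((𝓕⁻ (h2.toLp g) : Lp ℂ 2 (volume : Measure (𝔼 d))) : 𝔼 d → ℂ) =ᵐ[volume] 𝓕⁻ g := by
  refine ae_eq_of_integral_contDiff_smul_eq ((Lp.memLp _).locallyIntegrable one_le_two)
    (continuous_fourierInv h1).locallyIntegrable fun φ hφ1 hφ2 => ?_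
  have hψ1 : HasCompactSupport (Complex.ofRealCLM ∘ φ) := hφ2.comp_left rfl
  have hψ2 : ContDiff ℝ (⊤ : ℕ∞) (Complex.ofRealCLM ∘ φ) := by fun_prop
  set ψ : 𝓢(𝔼 d, ℂ) := hψ1.toSchwartzMap hψ2 with hψ
  have hval : ∀ x, ψ x = (φ x : ℂ) := fun x => rfl
  have h := congrArg (fun D => D ψ) (Lp.fourierInv_toTemperedDistribution_eq (h2.toLp g))
  simp only [TemperedDistribution.fourierInv_apply, Lp.toTemperedDistribution_apply,
    smul_eq_mul, hval] at h
  have h3 : ∫ x, φ x • 𝓕⁻ g x = ∫ x, (𝓕⁻ ψ) x * h2.toLp g x := by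
    have h4 := integral_fourierInv_mul_eq ψ.integrable h1
    calc ∫ x, φ x • 𝓕⁻ g x = ∫ x, ψ x * 𝓕⁻ g x := by simp [hval]
      _ = ∫ x, (𝓕⁻ ψ) x * g x := by rw [← h4, SchwartzMap.fourierInv_coe]
      _ = _ := by
        refine integral_congr_ae ?_
        filter_upwards [h2.coeFn_toLp] with x hx
        rw [hx]
  rw [h3, h]
  simp

/-- The Fourier multiplier operator on `L^2` with a bounded symbol. -/
noncomputable def l2Multiplier {d : ℕ} (b : 𝔼 d → ℂ) (hb : MemLp b ∞ volume) :
    Lp ℂ 2 (volume : Measure (𝔼 d)) →L[ℂ] Lp ℂ 2 (volume : Measure (𝔼 d)) :=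
  (Lp.fourierTransformₗᵢ (𝔼 d) ℂ).symm.toContinuousLinearEquiv.toContinuousLinearMap ∘L
    (ContinuousLinearMap.mul ℂ ℂ).holderL volume ∞ 2 2 (hb.toLp b) ∘L
    (Lp.fourierTransformₗᵢ (𝔼 d) ℂ).toContinuousLinearEquiv.toContinuousLinearMap

theorem fourier_l2Multiplier {d : ℕ} {b : 𝔼 d → ℂ} (hb : MemLp b ∞ volume)
    (F : Lp ℂ 2 (volume : Measure (𝔼 d))) :
    (𝓕 (l2Multiplier b hb F) : Lp ℂ 2 (volume : Measure (𝔼 d))) =ᵐ[volume]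
      fun w => b w * (𝓕 F : Lp ℂ 2 (volume : Measure (𝔼 d))) w := by
  have h : (𝓕 (l2Multiplier b hb F) : Lp ℂ 2 (volume : Measure (𝔼 d))) =
      (ContinuousLinearMap.mul ℂ ℂ).holder 2 (hb.toLp b) (𝓕 F) :=
    (Lp.fourierTransformₗᵢ (𝔼 d) ℂ).apply_symm_apply _
  rw [h]
  filter_upwards [(ContinuousLinearMap.mul ℂ ℂ).coeFn_holder (r := 2) (hb.toLp b)
    (𝓕 F : Lp ℂ 2 (volume : Measure (𝔼 d))), hb.coeFn_toLp] with w h1 h2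
  rw [h1, h2]
  rfl

theorem eq_l2Multiplier_of_fourier_ae_eq {d : ℕ} {b : 𝔼 d → ℂ} (hb : MemLp b ∞ volume)
    {F G : Lp ℂ 2 (volume : Measure (𝔼 d))}
    (h : (𝓕 G : Lp ℂ 2 (volume : Measure (𝔼 d))) =ᵐ[volume]
      fun w => b w * (𝓕 F : Lp ℂ 2 (volume : Measure (𝔼 d))) w) : G = l2Multiplier b hb F :=
  (Lp.fourierTransformₗᵢ (𝔼 d) ℂ).injective
    (Lp.ext (h.trans (fourier_l2Multiplier hb F).symm))

theorem integrable_symbol_mul_fourier {d : ℕ} {b : 𝔼 d → ℂ} (hb : MemLp b ∞ volume)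
    (f : 𝓢(𝔼 d, ℂ)) : Integrable fun w => b w * 𝓕 (f : 𝔼 d → ℂ) w := by
  rw [← SchwartzMap.fourier_coe, ← memLp_one_iff_integrable]
  exact ((𝓕 f).memLp 1 volume).mul hb

theorem memLp_symbol_mul_fourier {d : ℕ} {b : 𝔼 d → ℂ} (hb : MemLp b ∞ volume)
    (f : 𝓢(𝔼 d, ℂ)) : MemLp (fun w => b w * 𝓕 (f : 𝔼 d → ℂ) w) 2 volume := by
  rw [← SchwartzMap.fourier_coe]
  exact ((𝓕 f).memLp 2 volume).mul hb

theorem l2Multiplier_toLp_ae_eq {d : ℕ} {b : 𝔼 d → ℂ} (hb : MemLp b ∞ volume)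
    (f : 𝓢(𝔼 d, ℂ)) :
    (l2Multiplier b hb (f.toLp 2 volume) : 𝔼 d → ℂ) =ᵐ[volume] fourierMultiplier b f := by
  have h2 := memLp_symbol_mul_fourier hb f
  have h : 𝓕⁻ (h2.toLp _) = l2Multiplier b hb (f.toLp 2 volume) := by
    refine eq_l2Multiplier_of_fourier_ae_eq hb ?_
    rw [fourier_fourierInv_eq, SchwartzMap.toLp_fourier_eq]
    filter_upwards [h2.coeFn_toLp, (𝓕 f).coeFn_toLp 2 volume] with w h3 h4
    rw [h3, h4, SchwartzMap.fourier_coe]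
  rw [← h]
  exact fourierInv_toLp_ae_eq (integrable_symbol_mul_fourier hb f) h2

theorem continuous_fourierMultiplier {d : ℕ} {b : 𝔼 d → ℂ} (hb : MemLp b ∞ volume)
    (f : 𝓢(𝔼 d, ℂ)) : Continuous (fourierMultiplier b f) :=
  continuous_fourierInv (integrable_symbol_mul_fourier hb f)

/-! ## The normalization of the Bochner-Riesz means -/

/-- The Bochner-Riesz symbol in the normalization `e^{2πi x·w}`. -/
noncomputable def rescaledSymbol {d : ℕ} (δ : ℝ) (w : 𝔼 d) : ℝ :=
  bochnerRieszSymbol δ ((2 * Real.pi) • w)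

theorem fourierHat_two_pi_smul {d : ℕ} (f : 𝔼 d → ℂ) (w : 𝔼 d) :
    fourierHat f ((2 * Real.pi) • w) = 𝓕 f w := by
  rw [fourierHat, Real.fourier_eq']
  refine integral_congr_ae (Filter.Eventually.of_forall fun x => ?_)
  simp only [smul_eq_mul, inner_smul_right]
  rw [mul_comm]
  congr 2
  push_cast
  ring

/-- Substitute ξ = 2πw: the Jacobian absorbs the factor (2π)^{-d}. -/
theorem bochnerRiesz_eq_fourierMultiplier {d : ℕ} (δ : ℝ) (f : 𝓢(𝔼 d, ℂ)) :
    bochnerRiesz δ f = fourierMultiplier (fun w => (rescaledSymbol δ w : ℂ)) f := by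
  ext x
  have h := Measure.integral_comp_smul (volume : Measure (𝔼 d))
    (fun ξ => ((bochnerRieszSymbol δ ξ : ℂ) * fourierHat (fun x => f x) ξ) *
      Complex.exp (Complex.I * ((inner ℝ x ξ : ℝ) : ℂ))) (2 * Real.pi)
  rw [bochnerRiesz, fourierCheck, fourierMultiplier, Real.fourierInv_eq']
  rw [finrank_euclideanSpace, Fintype.card_fin, abs_of_nonneg (by positivity),
    Complex.real_smul] at h
  rw [← h]
  refine integral_congr_ae (Filter.Eventually.of_forall fun w => ?_)
  simp only [smul_eq_mul, fourierHat_two_pi_smul, rescaledSymbol, inner_smul_right]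
  rw [mul_comm]
  congr 2
  rw [real_inner_comm]
  push_cast
  ring

/-! ## Extension of multiplier operators to the Herz space -/

namespace HerzSpace

variable {d : ℕ} {α p q : ℝ} [hp : Fact (1 ≤ p)] [hq : Fact (1 ≤ q)]

/-- Limits in the Herz space and in `L^2` agree almost everywhere. -/
theorem ae_eq_of_tendsto {A : ℕ → HerzSpace d α p q} {B : ℕ → Lp ℂ 2 (volume : Measure (𝔼 d))}
    (hAB : ∀ n, (A n).fn =ᵐ[volume] B n) {a : HerzSpace d α p q}
    {b : Lp ℂ 2 (volume : Measure (𝔼 d))} (hA : Tendsto A atTop (𝓝 a))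
    (hB : Tendsto B atTop (𝓝 b)) : a.fn =ᵐ[volume] b := by
  obtain ⟨C₁, hC₁⟩ := lintegral_decayFun_mul_le (d := d) (α := α) hp.out hq.out
  obtain ⟨C₂, hC₂⟩ := lintegral_decayFun_mul_le (d := d) (α := 0) one_le_two one_le_two
  set L := herzDecay d α with hL
  -- The weight for exponent α decays at least as fast as the one for exponent 0, so it is
  -- admissible for both the Herz norm and L².
  have hmono : ∀ x : 𝔼 d, (decayFun L 0 x : ℝ≥0∞) ≤ decayFun (herzDecay d 0) 0 x := fun x => by
    refine ENNReal.ofReal_le_ofReal ?_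
    have h1 : (1 : ℝ) ≤ 1 + (2 ^ 0)⁻¹ * ‖x‖ := by simp
    gcongr
    rw [hL, herzDecay, herzDecay]
    simp
  have hma := a.measurable_fn
  have hmb := (Lp.stronglyMeasurable b).measurable
  have hdec := measurable_decayFun (d := d) L 0
  have hbound : ∀ n, ∫⁻ x, decayFun L 0 x * ‖a.fn x - b x‖ₑ ≤
      C₁ * ‖a - A n‖ₑ + C₂ * ‖B n - b‖ₑ := by
    intro n
    have hmA := (A n).measurable_fn
    have hmB := (Lp.stronglyMeasurable (B n)).measurable
    calc ∫⁻ x, decayFun L 0 x * ‖a.fn x - b x‖ₑ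
        ≤ ∫⁻ x, (decayFun L 0 x * ‖a.fn x - (A n).fn x‖ₑ +
            decayFun (herzDecay d 0) 0 x * ‖B n x - b x‖ₑ) := by
          refine lintegral_mono_ae ?_
          filter_upwards [hAB n] with x hx
          calc decayFun L 0 x * ‖a.fn x - b x‖ₑ
              = decayFun L 0 x * ‖(a.fn x - (A n).fn x) + (B n x - b x)‖ₑ := by
                rw [hx, sub_add_sub_cancel]
            _ ≤ decayFun L 0 x * (‖a.fn x - (A n).fn x‖ₑ + ‖B n x - b x‖ₑ) := by
                gcongr
                exact enorm_add_le _ _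
            _ ≤ _ := by
                rw [mul_add]
                gcongr
                exact hmono x
      _ = (∫⁻ x, decayFun L 0 x * ‖a.fn x - (A n).fn x‖ₑ) +
            ∫⁻ x, decayFun (herzDecay d 0) 0 x * ‖B n x - b x‖ₑ :=
          lintegral_add_left (hdec.mul (hma.sub hmA).enorm) _
      _ ≤ _ := by
          refine add_le_add ((hC₁ (fun x => ‖a.fn x - (A n).fn x‖ₑ) (hma.sub hmA).enorm).trans ?_)
            ((hC₂ (fun x => ‖B n x - b x‖ₑ) (hmB.sub hmb).enorm).trans ?_)
          · rw [enorm_eq_of_ae (coeFn_sub a (A n))]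
            gcongr
            exact herzLNorm_le_herzENorm hp.out hq.out _
          · rw [herzLNorm_zero_two (fun x => B n x - b x), Lp.enorm_def]
            gcongr
            exact (eLpNorm_congr_ae (Lp.coeFn_sub (B n) b)).ge
  have hlim : Tendsto (fun n => C₁ * ‖a - A n‖ₑ + C₂ * ‖B n - b‖ₑ) atTop (𝓝 0) := by
    have h1 : Tendsto (fun n => ‖a - A n‖ₑ) atTop (𝓝 0) := by
      simpa using ((tendsto_const_nhds (x := a)).sub hA).enorm
    have h2 : Tendsto (fun n => ‖B n - b‖ₑ) atTop (𝓝 0) := by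
      simpa using (hB.sub (tendsto_const_nhds (x := b))).enorm
    simpa using (ENNReal.Tendsto.const_mul h1 (Or.inr ENNReal.coe_ne_top)).add
      (ENNReal.Tendsto.const_mul h2 (Or.inr ENNReal.coe_ne_top))
  have hzero : ∫⁻ x, decayFun L 0 x * ‖a.fn x - b x‖ₑ = 0 :=
    le_antisymm (ge_of_tendsto' hlim hbound) zero_le
  rw [lintegral_eq_zero_iff (by fun_prop)] at hzero
  filter_upwards [hzero] with x hx
  have h0 : (decayFun L 0 x : ℝ≥0∞) ≠ 0 := by
    simp only [decayFun, ne_eq, ENNReal.ofReal_eq_zero, not_le]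
    positivity
  rcases mul_eq_zero.mp hx with h | h
  · exact absurd h h0
  · exact sub_eq_zero.mp (enorm_eq_zero.mp h)

theorem herzENorm_lt_top_of_decay (hα : -(d : ℝ) / p < α) {f : 𝔼 d → ℂ} {A : ℝ≥0}
    (h : ∀ x, ‖f x‖ₑ ≤ A * decayFun (herzDecay d α) 0 x) : herzENorm α p q f < ∞ := by
  obtain ⟨C, hC⟩ := exists_herzLNorm_decayFun_le (d := d) hp.out hq.out hα
  refine (herzENorm_le_two_mul hp.out hq.out f).trans_lt (ENNReal.mul_lt_top (by simp) ?_)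
  refine (herzLNorm_mono hp.out hq.out h).trans_lt ?_
  rw [herzLNorm_const_mul hp.out hq.out (measurable_decayFun _ _)]
  exact ENNReal.mul_lt_top ENNReal.coe_lt_top
    ((hC 0).trans_lt (ENNReal.mul_lt_top ENNReal.coe_lt_top ENNReal.ofReal_lt_top))

theorem herzENorm_schwartz_lt_top (hα : -(d : ℝ) / p < α) (f : 𝓢(𝔼 d, ℂ)) :
    herzENorm α p q f < ∞ := by
  set L := herzDecay d α
  obtain ⟨A, hA0, hA⟩ : ∃ A : ℝ, 0 ≤ A ∧ ∀ x, (1 + ‖x‖) ^ L * ‖f x‖ ≤ A :=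
    ⟨2 ^ L * (Finset.Iic (L, 0)).sup (fun m => SchwartzMap.seminorm ℝ m.1 m.2) f, by positivity,
      fun x => by
        simpa using SchwartzMap.one_add_le_sup_seminorm_apply (𝕜 := ℝ) (m := (L, 0))
          le_rfl le_rfl f x⟩
  refine herzENorm_lt_top_of_decay hα (A := A.toNNReal) fun x => ?_
  rw [← ofReal_norm, ← ENNReal.ofReal, decayFun, ← ENNReal.ofReal_mul hA0]
  refine ENNReal.ofReal_le_ofReal ?_
  rw [← div_eq_mul_inv, le_div_iff₀ (by positivity), mul_comm]
  simpa using hA x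

/-- The inclusion of the Schwartz functions into the Herz space. -/
noncomputable def ofSchwartz (hα : -(d : ℝ) / p < α) : 𝓢(𝔼 d, ℂ) →ₗ[ℂ] HerzSpace d α p q where
  toFun f := mk f f.continuous.aestronglyMeasurable (herzENorm_schwartz_lt_top hα f)
  map_add' f g := by
    refine ext_ae ((coeFn_mk _ _ _).trans ?_)
    refine EventuallyEq.trans ?_ (coeFn_add _ _).symm
    filter_upwards [coeFn_mk (α := α) (p := p) (q := q) f f.continuous.aestronglyMeasurable
      (herzENorm_schwartz_lt_top hα f), coeFn_mk (α := α) (p := p) (q := q) g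
      g.continuous.aestronglyMeasurable (herzENorm_schwartz_lt_top hα g)] with x h1 h2
    rw [h1, h2]
    rfl
  map_smul' c f := by
    refine ext_ae ((coeFn_mk _ _ _).trans ?_)
    refine EventuallyEq.trans ?_ (coeFn_smul _ _).symm
    filter_upwards [coeFn_mk (α := α) (p := p) (q := q) f f.continuous.aestronglyMeasurable
      (herzENorm_schwartz_lt_top hα f)] with x h1
    rw [h1]
    rfl

theorem coeFn_ofSchwartz (hα : -(d : ℝ) / p < α) (f : 𝓢(𝔼 d, ℂ)) :
    (ofSchwartz hα f : HerzSpace d α p q).fn =ᵐ[volume] f :=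
  coeFn_mk _ _ (herzENorm_schwartz_lt_top hα f)

theorem denseRange_ofSchwartz (hα : -(d : ℝ) / p < α) :
    DenseRange (ofSchwartz hα : 𝓢(𝔼 d, ℂ) → HerzSpace d α p q) := by
  intro F
  rw [EMetric.mem_closure_iff]
  intro ε hε
  obtain ⟨η, hη0, hη⟩ := exists_between hε
  obtain ⟨g, hg, -⟩ := exists_schwartz_approx hp.out hq.out F.aestronglyMeasurable
    F.herzENorm_lt_top hη0.ne'
  refine ⟨_, ⟨g, rfl⟩, ?_⟩
  rw [edist_eq_enorm_sub, enorm_eq_of_ae (f := fun x => F.fn x - g x)]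
  · exact hg.trans_lt hη
  · filter_upwards [coeFn_sub F (ofSchwartz hα g), coeFn_ofSchwartz (q := q) hα g] with x h1 h2
    rw [h1, h2]

/-- A Fourier multiplier operator which is bounded in the Herz norm on Schwartz functions extends
to a bounded operator on the Herz space which agrees with the multiplier operator on `L^2`. -/
theorem exists_multiplier_extension (hα : -(d : ℝ) / p < α) {b : 𝔼 d → ℂ}
    (hb : MemLp b ∞ volume) {C : ℝ≥0}
    (hC : ∀ f : 𝓢(𝔼 d, ℂ), herzENorm α p q (fourierMultiplier b f) ≤ C * herzENorm α p q f) :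
    ∃ T : HerzSpace d α p q →L[ℂ] HerzSpace d α p q,
      (∀ f : 𝓢(𝔼 d, ℂ), (T (ofSchwartz hα f)).fn =ᵐ[volume] fourierMultiplier b f) ∧
      ∀ (F : HerzSpace d α p q) (G : Lp ℂ 2 (volume : Measure (𝔼 d))),
        F.fn =ᵐ[volume] G → (T F).fn =ᵐ[volume] l2Multiplier b hb G := by
  have hfin : ∀ f : 𝓢(𝔼 d, ℂ), herzENorm α p q (fourierMultiplier b f) < ∞ := fun f =>
    (hC f).trans_lt (ENNReal.mul_lt_top ENNReal.coe_lt_top (herzENorm_schwartz_lt_top hα f))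
  have hm : ∀ f : 𝓢(𝔼 d, ℂ), AEStronglyMeasurable (fourierMultiplier b f) volume := fun f =>
    (continuous_fourierMultiplier hb f).aestronglyMeasurable
  have hcoe : ∀ f : 𝓢(𝔼 d, ℂ), (mk (fourierMultiplier b f) (hm f) (hfin f) :
      HerzSpace d α p q).fn =ᵐ[volume] l2Multiplier b hb (f.toLp 2 volume) := fun f =>
    (coeFn_mk _ _ _).trans (l2Multiplier_toLp_ae_eq hb f).symm
  -- Linearity is inherited from the L² operator, which represents the same functions.
  let B : 𝓢(𝔼 d, ℂ) →ₗ[ℂ] HerzSpace d α p q :=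
    { toFun := fun f => mk (fourierMultiplier b f) (hm f) (hfin f)
      map_add' := fun f g => by
        refine ext_ae ((hcoe _).trans (EventuallyEq.trans ?_ (coeFn_add _ _).symm))
        have h : (f + g).toLp 2 (volume : Measure (𝔼 d)) = f.toLp 2 volume + g.toLp 2 volume := rfl
        rw [h, map_add]
        filter_upwards [hcoe f, hcoe g, Lp.coeFn_add (l2Multiplier b hb (f.toLp 2 volume))
          (l2Multiplier b hb (g.toLp 2 volume))] with x h1 h2 h3
        rw [h1, h2, h3]
        rfl
      map_smul' := fun c f => by
        refine ext_ae ((hcoe _).trans (EventuallyEq.trans ?_ (coeFn_smul _ _).symm))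
        have h : (c • f).toLp 2 (volume : Measure (𝔼 d)) = c • f.toLp 2 volume := rfl
        rw [h, map_smul]
        filter_upwards [hcoe f, Lp.coeFn_smul c (l2Multiplier b hb (f.toLp 2 volume))] with x h1 h2
        rw [RingHom.id_apply, h1, h2]
        rfl }
  have hBcoe : ∀ f, (B f).fn =ᵐ[volume] fourierMultiplier b f := fun f => coeFn_mk _ _ (hfin f)
  have hBnorm : ∀ f, ‖B f‖ ≤ C * ‖(ofSchwartz hα f : HerzSpace d α p q)‖ := fun f => by
    have h : ‖B f‖ₑ ≤ C * ‖(ofSchwartz hα f : HerzSpace d α p q)‖ₑ := by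
      rw [enorm_eq_of_ae (hBcoe f), enorm_eq_of_ae (coeFn_ofSchwartz hα f)]
      exact hC f
    have h2 := ENNReal.toReal_mono (ENNReal.mul_ne_top ENNReal.coe_ne_top enorm_ne_top) h
    simpa using h2
  have hdense := denseRange_ofSchwartz (q := q) hα
  have hTB : ∀ f, B.extendOfNorm (ofSchwartz hα) (ofSchwartz hα f) = B f := fun f =>
    LinearMap.extendOfNorm_eq hdense ⟨C, hBnorm⟩ f
  refine ⟨B.extendOfNorm (ofSchwartz hα), fun f => ?_, fun F G hFG => ?_⟩
  · rw [hTB]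
    exact hBcoe f
  -- Schwartz functions converging to F in both norms have images converging in both norms, and the
  -- two limits coincide almost everywhere.
  · have hF2 : MemLp F.fn 2 volume := (memLp_congr_ae hFG).mpr (Lp.memLp G)
    have happrox : ∀ n : ℕ, ∃ g : 𝓢(𝔼 d, ℂ),
        herzENorm α p q (fun x => F.fn x - g x) ≤ ((n : ℝ≥0∞) + 1)⁻¹ ∧
        eLpNorm (fun x => F.fn x - g x) 2 volume ≤ ((n : ℝ≥0∞) + 1)⁻¹ := fun n => by
      obtain ⟨g, h1, h2⟩ := exists_schwartz_approx hp.out hq.out F.aestronglyMeasurable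
        F.herzENorm_lt_top (ε := ((n : ℝ≥0∞) + 1)⁻¹) (by simp)
      exact ⟨g, h1, h2 hF2⟩
    choose g hg1 hg2 using happrox
    have hε : Tendsto (fun n : ℕ => ((n : ℝ≥0∞) + 1)⁻¹) atTop (𝓝 0) := by
      have := ENNReal.tendsto_inv_nat_nhds_zero.comp (tendsto_add_atTop_nat 1)
      simpa [Function.comp_def] using this
    have hgF : Tendsto (fun n => (ofSchwartz hα (g n) : HerzSpace d α p q)) atTop (𝓝 F) := by
      rw [tendsto_iff_edist_tendsto_0]
      refine tendsto_of_tendsto_of_tendsto_of_le_of_le tendsto_const_nhds hε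
        (fun _ => zero_le) fun n => ?_
      dsimp only
      rw [edist_comm, edist_eq_enorm_sub, enorm_eq_of_ae (f := fun x => F.fn x - g n x)]
      · exact hg1 n
      · filter_upwards [coeFn_sub F (ofSchwartz hα (g n)), coeFn_ofSchwartz (q := q) hα (g n)]
          with x h1 h2
        rw [h1, h2]
    have hgG : Tendsto (fun n => (g n).toLp 2 (volume : Measure (𝔼 d))) atTop (𝓝 G) := by
      rw [tendsto_iff_edist_tendsto_0]
      refine tendsto_of_tendsto_of_tendsto_of_le_of_le tendsto_const_nhds hε
        (fun _ => zero_le) fun n => ?_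
      dsimp only
      rw [edist_comm, Lp.edist_def]
      refine le_trans (le_of_eq (eLpNorm_congr_ae ?_)) (hg2 n)
      filter_upwards [hFG, (g n).coeFn_toLp 2 volume] with x h1 h2
      rw [Pi.sub_apply, h1, h2]
    refine ae_eq_of_tendsto (A := fun n => B.extendOfNorm (ofSchwartz hα) (ofSchwartz hα (g n)))
      (B := fun n => l2Multiplier b hb ((g n).toLp 2 volume)) (fun n => ?_)
      (((B.extendOfNorm (ofSchwartz hα)).continuous.tendsto F).comp hgF)
      (((l2Multiplier b hb).continuous.tendsto G).comp hgG)
    rw [hTB]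
    exact hcoe (g n)

end HerzSpace

/-! ## Smoothness of powers of the Bochner-Riesz symbol -/

/-- The function `t_+^β (z - t_+^δ)^{-j}`. -/
noncomputable def powerProfile (δ β : ℝ) (z : ℂ) (j : ℕ) (t : ℝ) : ℂ :=
  ((max t 0 ^ β : ℝ) : ℂ) * (z - ((max t 0 ^ δ : ℝ) : ℂ))⁻¹ ^ j

/-- The set on which `z - t_+^δ` does not vanish. -/
def profileDomain (δ : ℝ) (z : ℂ) : Set ℝ := {t | z - ((max t 0 ^ δ : ℝ) : ℂ) ≠ 0}

theorem continuous_max_rpow {β : ℝ} (hβ : 0 < β) : Continuous fun t : ℝ => max t 0 ^ β :=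
  (continuous_id.max continuous_const).rpow_const fun _ => Or.inr hβ.le

theorem isOpen_profileDomain {δ : ℝ} (hδ : 0 < δ) (z : ℂ) : IsOpen (profileDomain δ z) :=
  isOpen_ne_fun (continuous_const.sub (Complex.continuous_ofReal.comp (continuous_max_rpow hδ)))
    continuous_const

theorem continuousOn_powerProfile {δ β : ℝ} (hδ : 0 < δ) (hβ : 0 < β) (z : ℂ) (j : ℕ) :
    ContinuousOn (powerProfile δ β z j) (profileDomain δ z) := by
  unfold powerProfile
  have h1 := Complex.continuous_ofReal.comp (continuous_max_rpow hβ)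
  have h2 := Complex.continuous_ofReal.comp (continuous_max_rpow hδ)
  exact h1.continuousOn.mul ((((continuous_const.sub h2).continuousOn).inv₀ fun t ht => ht).pow j)

/-- Away from 0 this is calculus; β > 1 is what gives derivative 0 at the origin. The point is that
the family is closed under differentiation. -/
theorem hasDerivAt_powerProfile {δ β : ℝ} (hδ : 0 < δ) (hβ : 1 < β) {z : ℂ} (j : ℕ) {t : ℝ}
    (ht : t ∈ profileDomain δ z) :
    HasDerivAt (powerProfile δ β z j) (β * powerProfile δ (β - 1) z j t +
      j * δ * powerProfile δ (β + δ - 1) z (j + 1) t) t := by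
  rcases lt_trichotomy t 0 with h | rfl | h
  · have hz : powerProfile δ β z j =ᶠ[𝓝 t] fun _ => 0 := by
      filter_upwards [Iio_mem_nhds h] with s hs
      simp [powerProfile, max_eq_right (Set.mem_Iio.mp hs).le,
        Real.zero_rpow (show β ≠ 0 by linarith)]
    refine HasDerivAt.congr_of_eventuallyEq ?_ hz
    convert hasDerivAt_const t (0 : ℂ) using 1
    simp [powerProfile, max_eq_right h.le, Real.zero_rpow (show β - 1 ≠ 0 by linarith),
      Real.zero_rpow (show β + δ - 1 ≠ 0 by linarith)]
  -- At 0, one factor t_+ is split off; the remaining profile with exponent β - 1 > 0 tends to 0, so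
  -- the product is o(t).
  · have hval : (β : ℂ) * powerProfile δ (β - 1) z j 0 +
        j * δ * powerProfile δ (β + δ - 1) z (j + 1) 0 = 0 := by
      simp [powerProfile, Real.zero_rpow (show β - 1 ≠ 0 by linarith),
        Real.zero_rpow (show β + δ - 1 ≠ 0 by linarith)]
    rw [hval, hasDerivAt_iff_isLittleO]
    have h0 : powerProfile δ β z j 0 = 0 := by
      simp [powerProfile, Real.zero_rpow (show β ≠ 0 by linarith)]
    have hsplit : ∀ s, powerProfile δ β z j s =
        powerProfile δ (β - 1) z j s * ((max s 0 : ℝ) : ℂ) := fun s => by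
      have : max s 0 ^ β = max s 0 ^ (β - 1) * max s 0 := by
        rcases (le_max_right s 0).eq_or_lt with h1 | h1
        · rw [← h1, Real.zero_rpow (by linarith), mul_zero]
        · rw [← Real.rpow_add_one h1.ne', sub_add_cancel]
      simp only [powerProfile]
      rw [this]
      push_cast
      ring
    have hcont := (continuousOn_powerProfile hδ (show 0 < β - 1 by linarith) z j).continuousAt
      ((isOpen_profileDomain hδ z).mem_nhds ht)
    have hz0 : powerProfile δ (β - 1) z j 0 = 0 := by
      simp [powerProfile, Real.zero_rpow (show β - 1 ≠ 0 by linarith)]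
    have hlo : (powerProfile δ (β - 1) z j) =o[𝓝 0] fun _ => (1 : ℝ) := by
      rw [Asymptotics.isLittleO_one_iff]
      rw [ContinuousAt, hz0] at hcont
      exact hcont
    have hbo : (fun s : ℝ => ((max s 0 : ℝ) : ℂ)) =O[𝓝 0] fun s => s := by
      refine Asymptotics.IsBigO.of_bound 1 (Eventually.of_forall fun s => ?_)
      rw [Complex.norm_real]
      rcases le_total s 0 with h1 | h1
      · simp [max_eq_right h1]
      · simp [max_eq_left h1]
    simpa [h0, hsplit] using hlo.mul_isBigO hbo
  · have heq : powerProfile δ β z j =ᶠ[𝓝 t] fun s : ℝ =>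
        ((s ^ β : ℝ) : ℂ) * (z - ((s ^ δ : ℝ) : ℂ))⁻¹ ^ j := by
      filter_upwards [Ioi_mem_nhds h] with s hs
      simp [powerProfile, max_eq_left (Set.mem_Ioi.mp hs).le]
    refine HasDerivAt.congr_of_eventuallyEq ?_ heq
    have hne : z - ((t ^ δ : ℝ) : ℂ) ≠ 0 := by
      have := ht
      rwa [profileDomain, Set.mem_ofPred_eq, max_eq_left h.le] at this
    have h1 : ∀ γ : ℝ, HasDerivAt (fun s : ℝ => ((s ^ γ : ℝ) : ℂ)) ((γ * t ^ (γ - 1) : ℝ) : ℂ) t :=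
      fun γ => (Real.hasDerivAt_rpow_const (Or.inl h.ne')).ofReal_comp
    have h2 := (h1 β).mul ((((h1 δ).const_sub z).inv hne).pow j)
    refine h2.congr_deriv ?_
    have h3 : t ^ (β + δ - 1) = t ^ β * t ^ (δ - 1) := by
      rw [← Real.rpow_add h]; congr 1; ring
    simp only [powerProfile, max_eq_left h.le, h3]
    cases j with
    | zero => simp
    | succ j =>
      simp only [Pi.pow_apply, Pi.inv_apply, add_tsub_cancel_right]
      push_cast
      rw [neg_neg, div_eq_mul_inv, ← inv_pow]
      ring

/-- Induction on J: the derivative involves only the exponents β - 1 and β + δ - 1, both above J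
when β > J + 1. -/
theorem contDiffOn_powerProfile {δ : ℝ} (hδ : 0 < δ) (z : ℂ) (J : ℕ) :
    ∀ (β : ℝ) (j : ℕ), (J : ℝ) < β →
      ContDiffOn ℝ J (powerProfile δ β z j) (profileDomain δ z) := by
  induction J with
  | zero =>
    intro β j hβ
    exact contDiffOn_zero.mpr (continuousOn_powerProfile hδ (by simpa using hβ) z j)
  | succ J ih =>
    intro β j hβ
    push_cast at hβ
    have hβ1 : 1 < β := by linarith [Nat.cast_nonneg (α := ℝ) J]
    have h := contDiffOn_succ_iff_deriv_of_isOpen (𝕜 := ℝ) (n := (J : WithTop ℕ∞))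
      (f := powerProfile δ β z j) (isOpen_profileDomain hδ z)
    push_cast
    rw [h]
    refine ⟨fun t ht => (hasDerivAt_powerProfile hδ hβ1 j ht).differentiableAt.differentiableWithinAt,
      by simp, ?_⟩
    refine ContDiffOn.congr ?_ fun t ht => (hasDerivAt_powerProfile hδ hβ1 j ht).deriv
    exact (contDiffOn_const.mul (ih (β - 1) j (by linarith))).add
      (contDiffOn_const.mul (ih (β + δ - 1) (j + 1) (by linarith)))

/-- The symbol `m^n (z - m)^{-j}`, where `m` is the rescaled Bochner-Riesz symbol. -/
noncomputable def resolventSymbol {d : ℕ} (δ : ℝ) (n : ℕ) (z : ℂ) (j : ℕ) (w : 𝔼 d) : ℂ :=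
  (rescaledSymbol δ w : ℂ) ^ n * (z - rescaledSymbol δ w)⁻¹ ^ j

/-- The unit interval in the complex plane. -/
def unitSegment : Set ℂ := {z : ℂ | ∃ t : ℝ, 0 ≤ t ∧ t ≤ 1 ∧ z = (t : ℂ)}

theorem rescaledSymbol_nonneg {d : ℕ} (δ : ℝ) (w : 𝔼 d) : 0 ≤ rescaledSymbol δ w :=
  Real.rpow_nonneg (le_max_right _ _) _

theorem rescaledSymbol_le_one {d : ℕ} {δ : ℝ} (hδ : 0 < δ) (w : 𝔼 d) : rescaledSymbol δ w ≤ 1 :=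
  Real.rpow_le_one (le_max_right _ _) (max_le (by simp) zero_le_one) hδ.le

theorem sub_rescaledSymbol_ne_zero {d : ℕ} {δ : ℝ} (hδ : 0 < δ) {z : ℂ} (hz : z ∉ unitSegment)
    (w : 𝔼 d) : z - rescaledSymbol δ w ≠ 0 := fun h =>
  hz ⟨_, rescaledSymbol_nonneg δ w, rescaledSymbol_le_one hδ w, sub_eq_zero.mp h⟩

theorem continuous_rescaledSymbol {d : ℕ} {δ : ℝ} (hδ : 0 < δ) :
    Continuous (rescaledSymbol δ : 𝔼 d → ℝ) := by
  have h : Continuous fun w : 𝔼 d => 1 - ‖(2 * Real.pi) • w‖ ^ 2 := by fun_prop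
  exact (continuous_max_rpow hδ).comp h

theorem rescaledSymbol_eq_zero {d : ℕ} {δ : ℝ} (hδ : 0 < δ) {w : 𝔼 d} (hw : 1 ≤ ‖w‖) :
    rescaledSymbol δ w = 0 := by
  have h1 : 1 ≤ ‖(2 * Real.pi) • w‖ := by
    rw [norm_smul, Real.norm_of_nonneg (by positivity)]
    nlinarith [Real.pi_gt_three]
  rw [rescaledSymbol, bochnerRieszSymbol, max_eq_right (by nlinarith), Real.zero_rpow hδ.ne']

theorem continuous_resolventSymbol {d : ℕ} {δ : ℝ} (hδ : 0 < δ) (n : ℕ) {z : ℂ}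
    (hz : z ∉ unitSegment) (j : ℕ) : Continuous (resolventSymbol δ n z j : 𝔼 d → ℂ) := by
  have h := Complex.continuous_ofReal.comp (continuous_rescaledSymbol (d := d) hδ)
  exact (h.pow n).mul (((continuous_const.sub h).inv₀ (sub_rescaledSymbol_ne_zero hδ hz)).pow j)

theorem hasCompactSupport_resolventSymbol {d : ℕ} {δ : ℝ} (hδ : 0 < δ) {n : ℕ} (hn : n ≠ 0) (z : ℂ)
    (j : ℕ) : HasCompactSupport (resolventSymbol δ n z j : 𝔼 d → ℂ) := by
  refine HasCompactSupport.intro (isCompact_closedBall (0 : 𝔼 d) 1) fun w hw => ?_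
  rw [mem_closedBall_zero_iff, not_le] at hw
  simp [resolventSymbol, rescaledSymbol_eq_zero hδ hw.le, hn]

/-- The symbol is the profile with β = δn composed with the smooth function 1 - |2πw|². The power n
supplies the smoothness that m itself lacks at the unit sphere, and z outside [0,1] keeps the
denominator away from zero. -/
theorem contDiff_resolventSymbol {d : ℕ} {δ : ℝ} (hδ : 0 < δ) {n J : ℕ} (hn : (J : ℝ) < δ * n)
    {z : ℂ} (hz : z ∉ unitSegment) (j : ℕ) :
    ContDiff ℝ J (resolventSymbol δ n z j : 𝔼 d → ℂ) := by
  have h1 : (resolventSymbol δ n z j : 𝔼 d → ℂ) =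
      powerProfile δ (δ * n) z j ∘ fun w : 𝔼 d => 1 - ‖(2 * Real.pi) • w‖ ^ 2 := by
    ext w
    simp only [resolventSymbol, rescaledSymbol, bochnerRieszSymbol, powerProfile,
      Function.comp_apply, Real.rpow_mul_natCast (le_max_right _ _)]
    push_cast
    rfl
  rw [h1]
  have h2 : ContDiff ℝ J fun w : 𝔼 d => 1 - ‖(2 * Real.pi) • w‖ ^ 2 :=
    contDiff_const.sub (ContDiff.norm_sq ℝ (contDiff_id.const_smul (2 * Real.pi)))
  have h3 : ∀ w : 𝔼 d, 1 - ‖(2 * Real.pi) • w‖ ^ 2 ∈ profileDomain δ z := fun w => by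
    rw [profileDomain, Set.mem_ofPred_eq]
    exact sub_rescaledSymbol_ne_zero hδ hz w
  exact ContDiffOn.comp_contDiff (contDiffOn_powerProfile hδ z J _ j hn) h2 h3

theorem memLp_top_of_continuous_of_hasCompactSupport {d : ℕ} {b : 𝔼 d → ℂ} (hb : Continuous b)
    (hs : HasCompactSupport b) : MemLp b ∞ volume :=
  hb.memLp_of_hasCompactSupport hs

/-- Integrable derivatives of orders 0 and J bound the kernel and |x|^J times the kernel; then (1 +
|x|)^J ≤ 2^J (1 + |x|^J). -/
theorem exists_fourierInv_decay {d : ℕ} {b : 𝔼 d → ℂ} {J : ℕ} (hb : ContDiff ℝ J b)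
    (hs : HasCompactSupport b) :
    ∃ A : ℝ≥0, ∀ x, ‖𝓕⁻ b x‖ₑ ≤ A * decayFun J 0 x := by
  have hpow : ∀ m ≤ J, ∃ C : ℝ, ∀ x, ‖x‖ ^ m * ‖𝓕⁻ b x‖ ≤ C := by
    intro m hm
    suffices h : ∃ C : ℝ, ∀ x, ‖x‖ ^ m * ‖iteratedFDeriv ℝ 0 (𝓕 b) x‖ ≤ C by
      obtain ⟨C, hC⟩ := h
      refine ⟨C, fun x => ?_⟩
      rw [Real.fourierInv_eq_fourier_neg, ← norm_neg x]
      simpa only [norm_iteratedFDeriv_zero] using hC (-x)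
    exact ⟨_, fun x => Real.pow_mul_norm_iteratedFDeriv_fourier_le (K := 0) (N := (J : ℕ∞)) hb
      (fun k n hk hn => by
        have hk0 : k = 0 := by simpa using hk
        subst hk0
        simp only [pow_zero, one_mul]
        refine Integrable.norm (Continuous.integrable_of_hasCompactSupport
          (hb.continuous_iteratedFDeriv (by exact_mod_cast hn)) (hs.iteratedFDeriv n)))
      (k := 0) (n := m) (by simp) (by exact_mod_cast hm) x⟩
  obtain ⟨C₀, hC₀⟩ := hpow 0 (Nat.zero_le _)
  obtain ⟨C₁, hC₁⟩ := hpow J le_rfl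
  have h00 : 0 ≤ C₀ := le_trans (by positivity) (hC₀ 0)
  have h10 : 0 ≤ C₁ := le_trans (by positivity) (hC₁ 0)
  have hA : 0 ≤ 2 ^ J * (C₀ + C₁) := by positivity
  refine ⟨(2 ^ J * (C₀ + C₁)).toNNReal, fun x => ?_⟩
  rw [← ofReal_norm, ← ENNReal.ofReal, decayFun, ← ENNReal.ofReal_mul hA]
  refine ENNReal.ofReal_le_ofReal ?_
  rw [← div_eq_mul_inv, le_div_iff₀ (by positivity)]
  simp only [pow_zero, inv_one, one_mul]
  have h1 : (1 + ‖x‖) ^ J ≤ 2 ^ J * (1 + ‖x‖ ^ J) := by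
    have h := add_pow_le (zero_le_one (α := ℝ)) (norm_nonneg x) J
    rw [one_pow] at h
    refine h.trans ?_
    gcongr
    · exact one_le_two
    · omega
  have h2 := hC₀ x
  have h3 := hC₁ x
  rw [pow_zero, one_mul] at h2
  calc ‖𝓕⁻ b x‖ * (1 + ‖x‖) ^ J ≤ ‖𝓕⁻ b x‖ * (2 ^ J * (1 + ‖x‖ ^ J)) := by gcongr
    _ = 2 ^ J * (‖𝓕⁻ b x‖ + ‖x‖ ^ J * ‖𝓕⁻ b x‖) := by ring
    _ ≤ _ := by gcongr

/-- A multiplier whose kernel decays rapidly is bounded in the Herz norm. -/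
theorem exists_herzENorm_fourierMultiplier_le {d : ℕ} {α p q : ℝ} (hp : 1 ≤ p) (hq : 1 ≤ q)
    (hα : -(d : ℝ) / p < α) {b : 𝔼 d → ℂ} (hb : Integrable b) {A : ℝ≥0}
    (hA : ∀ x, ‖𝓕⁻ b x‖ₑ ≤ A * decayFun (2 * herzDecay d α) 0 x) :
    ∃ C : ℝ≥0, ∀ f : 𝓢(𝔼 d, ℂ),
      herzENorm α p q (fourierMultiplier b f) ≤ C * herzENorm α p q f := by
  obtain ⟨C, hC⟩ := exists_herzLNorm_convolution_le (d := d) hp hq hα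
  refine ⟨2 * (A * C), fun f => ?_⟩
  have hdec := measurable_decayFun (d := d) (2 * herzDecay d α) 0
  have hf : Measurable fun x => ‖f x‖ₑ := f.continuous.measurable.enorm
  have hpt : ∀ x, ‖fourierMultiplier b f x‖ₑ ≤
      A * ∫⁻ y, decayFun (2 * herzDecay d α) 0 (x - y) * ‖f y‖ₑ := by
    intro x
    rw [fourierMultiplier_eq_convolution hb f.integrable x, ← lintegral_const_mul _ (by fun_prop)]
    refine (enorm_integral_le_lintegral_enorm _).trans (lintegral_mono fun y => ?_)
    dsimp only
    rw [enorm_mul, ← mul_assoc]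
    gcongr
    exact hA _
  have hm : Measurable fun x : 𝔼 d =>
      ∫⁻ y, decayFun (2 * herzDecay d α) 0 (x - y) * ‖f y‖ₑ :=
    Measurable.lintegral_prod_right (f := fun x y : 𝔼 d =>
      decayFun (2 * herzDecay d α) 0 (x - y) * ‖f y‖ₑ)
      ((hdec.comp (measurable_fst.sub measurable_snd)).mul (hf.comp measurable_snd))
  calc herzENorm α p q (fourierMultiplier b f)
      ≤ 2 * herzLNorm α p q (fun x => ‖fourierMultiplier b f x‖ₑ) := herzENorm_le_two_mul hp hq _
    _ ≤ 2 * (A * (C * herzLNorm α p q (fun x => ‖f x‖ₑ))) := by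
        gcongr
        refine (herzLNorm_mono hp hq hpt).trans ?_
        rw [herzLNorm_const_mul hp hq hm]
        gcongr
        exact hC _ hf
    _ ≤ 2 * (A * (C * herzENorm α p q f)) := by
        gcongr
        exact herzLNorm_le_herzENorm hp hq _
    _ = _ := by push_cast; ring

/-! ## The calculus of multiplier operators -/

theorem l2Multiplier_mul {d : ℕ} {b c e : 𝔼 d → ℂ} (hb : MemLp b ∞ volume) (hc : MemLp c ∞ volume)
    (he : MemLp e ∞ volume) (h : ∀ w, e w = b w * c w) :
    l2Multiplier e he = l2Multiplier b hb * l2Multiplier c hc := by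
  ext1 F
  refine (eq_l2Multiplier_of_fourier_ae_eq he ?_).symm
  change (𝓕 (l2Multiplier b hb (l2Multiplier c hc F)) : Lp ℂ 2 (volume : Measure (𝔼 d))) =ᵐ[volume] _
  filter_upwards [fourier_l2Multiplier hb (l2Multiplier c hc F), fourier_l2Multiplier hc F]
    with w h1 h2
  rw [h1, h2, h, mul_assoc]

theorem l2Multiplier_add {d : ℕ} {b c e : 𝔼 d → ℂ} (hb : MemLp b ∞ volume) (hc : MemLp c ∞ volume)
    (he : MemLp e ∞ volume) (h : ∀ w, e w = b w + c w) :
    l2Multiplier e he = l2Multiplier b hb + l2Multiplier c hc := by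
  ext1 F
  refine (eq_l2Multiplier_of_fourier_ae_eq he ?_).symm
  rw [add_apply, FourierTransform.fourier_add]
  filter_upwards [fourier_l2Multiplier hb F, fourier_l2Multiplier hc F,
    Lp.coeFn_add (𝓕 (l2Multiplier b hb F) : Lp ℂ 2 (volume : Measure (𝔼 d)))
      (𝓕 (l2Multiplier c hc F))] with w h1 h2 h3
  rw [h3, Pi.add_apply, h1, h2, h, add_mul]

theorem l2Multiplier_smul {d : ℕ} {b e : 𝔼 d → ℂ} (z : ℂ) (hb : MemLp b ∞ volume)
    (he : MemLp e ∞ volume) (h : ∀ w, e w = z * b w) :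
    l2Multiplier e he = z • l2Multiplier b hb := by
  ext1 F
  refine (eq_l2Multiplier_of_fourier_ae_eq he ?_).symm
  rw [smul_apply, FourierTransform.fourier_smul]
  filter_upwards [fourier_l2Multiplier hb F,
    Lp.coeFn_smul z (𝓕 (l2Multiplier b hb F) : Lp ℂ 2 (volume : Measure (𝔼 d)))] with w h1 h3
  rw [h3, Pi.smul_apply, h1, h, smul_eq_mul, mul_assoc]

namespace HerzSpace

variable {d : ℕ} {α p q : ℝ} [hp : Fact (1 ≤ p)] [hq : Fact (1 ≤ q)]

/-- An operator on the Herz space and an operator on `L^2` agree on the common elements. -/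
def Agrees (T : HerzSpace d α p q →L[ℂ] HerzSpace d α p q)
    (M : Lp ℂ 2 (volume : Measure (𝔼 d)) →L[ℂ] Lp ℂ 2 (volume : Measure (𝔼 d))) : Prop :=
  ∀ (F : HerzSpace d α p q) (G : Lp ℂ 2 (volume : Measure (𝔼 d))),
    F.fn =ᵐ[volume] G → (T F).fn =ᵐ[volume] M G

namespace Agrees

variable {T S : HerzSpace d α p q →L[ℂ] HerzSpace d α p q}
  {M N : Lp ℂ 2 (volume : Measure (𝔼 d)) →L[ℂ] Lp ℂ 2 (volume : Measure (𝔼 d))}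

theorem mul (h₁ : Agrees T M) (h₂ : Agrees S N) : Agrees (T * S) (M * N) :=
  fun F G h => h₁ _ _ (h₂ F G h)

theorem one : Agrees (1 : HerzSpace d α p q →L[ℂ] HerzSpace d α p q) 1 := fun _ _ h => h

theorem pow (h : Agrees T M) (n : ℕ) : Agrees (T ^ n) (M ^ n) := by
  induction n with
  | zero => simpa using one
  | succ n ih => simpa [pow_succ] using ih.mul h

theorem add (h₁ : Agrees T M) (h₂ : Agrees S N) : Agrees (T + S) (M + N) := fun F G h => by
  filter_upwards [h₁ F G h, h₂ F G h, coeFn_add (T F) (S F), Lp.coeFn_add (M G) (N G)]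
    with x h1 h2 h3 h4
  simp only [add_apply]
  rw [h3, h4, h1, h2, Pi.add_apply]

theorem smul (z : ℂ) (h₁ : Agrees T M) : Agrees (z • T) (z • M) := fun F G h => by
  filter_upwards [h₁ F G h, coeFn_smul z (T F), Lp.coeFn_smul z (M G)] with x h1 h3 h4
  simp only [smul_apply]
  rw [h3, h4, h1, Pi.smul_apply, smul_eq_mul]

theorem ae_eq_schwartz {b : 𝔼 d → ℂ} (hα : -(d : ℝ) / p < α) {hb : MemLp b ∞ volume}
    (h : Agrees T (l2Multiplier b hb)) (f : 𝓢(𝔼 d, ℂ)) :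
    (T (ofSchwartz hα f)).fn =ᵐ[volume] fourierMultiplier b f :=
  (h _ _ ((coeFn_ofSchwartz hα f).trans (f.coeFn_toLp 2 volume).symm)).trans
    (l2Multiplier_toLp_ae_eq hb f)

/-- Schwartz functions are dense and belong to both spaces. This is how an identity between symbols
becomes one between operators on the Herz space. -/
theorem unique (hα : -(d : ℝ) / p < α) (h₁ : Agrees T M) (h₂ : Agrees S M) : T = S := by
  refine DFunLike.coe_injective ((denseRange_ofSchwartz hα).equalizer T.continuous S.continuous ?_)
  ext1 f
  have h := (coeFn_ofSchwartz (q := q) hα f).trans (f.coeFn_toLp 2 volume).symm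
  exact ext_ae ((h₁ _ _ h).trans (h₂ _ _ h).symm)

end Agrees

/-! ### The spectrum is contained in the unit interval -/

theorem memLp_resolventSymbol {δ : ℝ} (hδ : 0 < δ) {n : ℕ} (hn : n ≠ 0) {z : ℂ}
    (hz : z ∉ unitSegment) (j : ℕ) : MemLp (resolventSymbol δ n z j : 𝔼 d → ℂ) ∞ volume :=
  memLp_top_of_continuous_of_hasCompactSupport (continuous_resolventSymbol hδ n hz j)
    (hasCompactSupport_resolventSymbol hδ hn z j)

theorem memLp_rescaledSymbol {δ : ℝ} (hδ : 0 < δ) :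
    MemLp (fun w : 𝔼 d => (rescaledSymbol δ w : ℂ)) ∞ volume := by
  refine memLp_top_of_continuous_of_hasCompactSupport
    (Complex.continuous_ofReal.comp (continuous_rescaledSymbol hδ))
    (HasCompactSupport.intro (isCompact_closedBall (0 : 𝔼 d) 1) fun w hw => ?_)
  rw [mem_closedBall_zero_iff, not_le] at hw
  simp [rescaledSymbol_eq_zero hδ hw.le]

/-- For large n the kernel decays fast enough for the convolution estimate, whatever the size of δ.
-/
theorem exists_agrees_resolventSymbol (hα : -(d : ℝ) / p < α) {δ : ℝ} (hδ : 0 < δ) {n : ℕ}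
    (hn0 : n ≠ 0) (hn : ((2 * herzDecay d α : ℕ) : ℝ) < δ * n) {z : ℂ} (hz : z ∉ unitSegment)
    (j : ℕ) : ∃ S : HerzSpace d α p q →L[ℂ] HerzSpace d α p q,
      Agrees S (l2Multiplier _ (memLp_resolventSymbol hδ hn0 hz j)) := by
  have hs := hasCompactSupport_resolventSymbol (d := d) hδ hn0 z j
  obtain ⟨A, hA⟩ := exists_fourierInv_decay (contDiff_resolventSymbol (d := d) hδ hn hz j) hs
  obtain ⟨C, hC⟩ := exists_herzENorm_fourierMultiplier_le (α := α) hp.out hq.out hα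
    ((continuous_resolventSymbol hδ n hz j).integrable_of_hasCompactSupport hs) hA
  obtain ⟨S, -, hS⟩ := exists_multiplier_extension hα (memLp_resolventSymbol hδ hn0 hz j) hC
  exact ⟨S, hS⟩

theorem zero_mem_unitSegment : (0 : ℂ) ∈ unitSegment := ⟨0, le_rfl, zero_le_one, by simp⟩

theorem neg_one_notMem_unitSegment : (-1 : ℂ) ∉ unitSegment := by
  rintro ⟨t, h0, -, h⟩
  have : (-1 : ℝ) = t := by exact_mod_cast h
  linarith

/-- With j = 0 the symbol is just m^n, and z plays no role. -/
theorem l2Multiplier_rescaledSymbol_pow {δ : ℝ} (hδ : 0 < δ) {n : ℕ} (hn : n ≠ 0) {z : ℂ}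
    (hz : z ∉ unitSegment) : l2Multiplier _ (memLp_resolventSymbol (d := d) hδ hn hz 0) =
      l2Multiplier _ (memLp_rescaledSymbol hδ) ^ n := by
  induction n, Nat.one_le_iff_ne_zero.mpr hn using Nat.le_induction with
  | base =>
    rw [pow_one]
    congr 1
    ext w
    simp [resolventSymbol]
  | succ n hn1 ih =>
    rw [pow_succ, ← ih (by omega)]
    exact l2Multiplier_mul _ _ _ fun w => by simp [resolventSymbol, pow_succ]

/-- `z - T` is invertible away from the unit interval. -/
theorem spectrum_subset_unitSegment (hα : -(d : ℝ) / p < α) {δ : ℝ} (hδ : 0 < δ)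
    {T : HerzSpace d α p q →L[ℂ] HerzSpace d α p q}
    (hT : Agrees T (l2Multiplier _ (memLp_rescaledSymbol hδ))) : spectrum ℂ T ⊆ unitSegment := by
  intro z hzs
  by_contra hz
  obtain ⟨n, hn⟩ := exists_nat_gt (((2 * herzDecay d α : ℕ) : ℝ) / δ)
  rw [div_lt_iff₀' hδ] at hn
  have hn0 : n ≠ 0 := by
    rintro rfl
    simp only [Nat.cast_zero, mul_zero] at hn
    exact absurd hn (not_lt.mpr (Nat.cast_nonneg _))
  have hz0 : z ≠ 0 := fun h => hz (h ▸ zero_mem_unitSegment)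
  obtain ⟨S, hS⟩ := exists_agrees_resolventSymbol (p := p) (q := q) hα hδ hn0 hn hz 1
  have hmem := memLp_resolventSymbol (d := d) hδ hn0 hz 1
  have hmemz : MemLp (fun w : 𝔼 d => z * resolventSymbol δ n z 1 w) ∞ volume := hmem.const_mul z
  have hmem' := memLp_resolventSymbol (d := d) hδ n.succ_ne_zero hz 1
  have hTn := hT.pow n
  rw [← l2Multiplier_rescaledSymbol_pow hδ hn0 hz] at hTn
  have hTS := hT.mul hS
  have hST := hS.mul hT
  rw [← l2Multiplier_mul _ _ hmem' fun w => by simp only [resolventSymbol, pow_succ]; ring] at hTS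
  rw [← l2Multiplier_mul _ _ hmem' fun w => by simp only [resolventSymbol, pow_succ]; ring] at hST
  have hcomm : T * S = S * T := hTS.unique hα hST
  -- This is the symbol identity z m^n/(z - m) = m · m^n/(z - m) + m^n.
  have hres : z • S = T * S + T ^ n := by
    have h1 := hS.smul z
    have h2 := hTS.add hTn
    rw [← l2Multiplier_smul z _ hmemz fun w => rfl] at h1
    rw [← l2Multiplier_add _ _ hmemz] at h2
    · exact h1.unique hα h2
    · intro w
      have hne := sub_rescaledSymbol_ne_zero hδ hz w
      simp only [resolventSymbol, pow_one, pow_zero, mul_one]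
      rw [pow_succ]
      field_simp
      ring
  set Z := algebraMap ℂ (HerzSpace d α p q →L[ℂ] HerzSpace d α p q) z with hZ
  have hZT : Commute Z T := Algebra.commutes z T
  have hZS : z • S = Z * S := Algebra.smul_def z S
  rw [hZS] at hres
  -- The geometric sum telescopes to Z^n - T^n, and (Z - T) S supplies the missing T^n. Since Z is
  -- an invertible scalar, Z - T has a right inverse; `h2` gives a left inverse.
  have h1 : (Z - T) * (∑ i ∈ Finset.range n, Z ^ i * T ^ (n - 1 - i) + S) = Z ^ n := by
    rw [mul_add, hZT.mul_geom_sum₂, sub_mul, hres]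
    abel
  have h2 : (∑ i ∈ Finset.range n, Z ^ i * T ^ (n - 1 - i) + S) * (Z - T) = Z ^ n := by
    rw [add_mul, hZT.geom_sum₂_mul, mul_sub, ← hcomm, ← Algebra.commutes z S, ← hZ, hres]
    abel
  have hu : IsUnit (Z ^ n) := ((isUnit_iff_ne_zero.mpr hz0).map _).pow n
  refine hzs ?_
  obtain ⟨u, hu⟩ := hu
  rw [← hu] at h1 h2
  exact isUnit_iff_exists_and_exists.mpr
    ⟨⟨_, by rw [← mul_assoc, h1, Units.mul_inv]⟩, ⟨_, by rw [mul_assoc, h2, Units.inv_mul]⟩⟩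

end HerzSpace

/-! ## Approximate eigenfunctions -/

/-- A smooth bump function equal to one on the unit ball. -/
noncomputable def unitBump (d : ℕ) : ContDiffBump (0 : 𝔼 d) := ⟨1, 2, one_pos, one_lt_two⟩

/-- The character `e^{2πi x·w}`. -/
noncomputable def planeWave {d : ℕ} (w x : 𝔼 d) : ℂ :=
  Complex.exp ((2 * Real.pi * inner ℝ x w : ℝ) * Complex.I)

theorem norm_planeWave {d : ℕ} (w x : 𝔼 d) : ‖planeWave w x‖ = 1 :=
  Complex.norm_exp_ofReal_mul_I _

/-- The modulated bump function at scale `2^N`. -/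
noncomputable def wavePacketFun {d : ℕ} (w : 𝔼 d) (N : ℕ) (x : 𝔼 d) : ℂ :=
  (unitBump d (((2 : ℝ) ^ N)⁻¹ • x) : ℂ) * planeWave w x

theorem contDiff_wavePacketFun {d : ℕ} (w : 𝔼 d) (N : ℕ) :
    ContDiff ℝ (⊤ : ℕ∞) (wavePacketFun w N) := by
  have h1 : ContDiff ℝ (⊤ : ℕ∞) fun x : 𝔼 d => unitBump d (((2 : ℝ) ^ N)⁻¹ • x) :=
    (unitBump d).contDiff.comp (contDiff_id.const_smul _)
  have h2 : ContDiff ℝ (⊤ : ℕ∞) (planeWave w) := by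
    unfold planeWave
    have h3 : ContDiff ℝ (⊤ : ℕ∞) fun x : 𝔼 d => 2 * Real.pi * inner ℝ x w :=
      contDiff_const.mul (contDiff_id.inner ℝ contDiff_const)
    exact ((Complex.ofRealCLM.contDiff.comp h3).mul contDiff_const).cexp
  exact (Complex.ofRealCLM.contDiff.comp h1).mul h2

theorem hasCompactSupport_wavePacketFun {d : ℕ} (w : 𝔼 d) (N : ℕ) :
    HasCompactSupport (wavePacketFun w N) := by
  have h1 : HasCompactSupport fun x : 𝔼 d => unitBump d (((2 : ℝ) ^ N)⁻¹ • x) :=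
    (unitBump d).hasCompactSupport.comp_smul (by positivity)
  exact (h1.comp_left (g := fun t : ℝ => (t : ℂ)) rfl).mul_right

/-- The modulated bump function at scale `2^N` as a Schwartz function. -/
noncomputable def wavePacket {d : ℕ} (w : 𝔼 d) (N : ℕ) : 𝓢(𝔼 d, ℂ) :=
  (hasCompactSupport_wavePacketFun w N).toSchwartzMap (contDiff_wavePacketFun w N)

theorem wavePacket_apply {d : ℕ} (w : 𝔼 d) (N : ℕ) (x : 𝔼 d) :
    wavePacket w N x = (unitBump d (((2 : ℝ) ^ N)⁻¹ • x) : ℂ) * planeWave w x := rfl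

/-- If both points lie where the bump vanishes, there is nothing to prove. Otherwise 1 + |u| ≤ 3(1 +
|u - v|), so the decay factor in u can be inserted into the Lipschitz bound at the cost of 3^L. -/
theorem exists_unitBump_sub_le (d L : ℕ) : ∃ K : ℝ, 0 ≤ K ∧ ∀ u v : 𝔼 d,
    |unitBump d u - unitBump d v| ≤ K * ‖u - v‖ * ((1 + ‖u - v‖) ^ L * ((1 + ‖u‖) ^ L)⁻¹) := by
  obtain ⟨K, hK⟩ := ContDiff.lipschitzWith_of_hasCompactSupport (𝕂 := ℝ) (n := 1)
    (unitBump d).hasCompactSupport (unitBump d).contDiff one_ne_zero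
  refine ⟨K * 3 ^ L, by positivity, fun u v => ?_⟩
  have hlip : |unitBump d u - unitBump d v| ≤ K * ‖u - v‖ := by
    simpa [Real.dist_eq, dist_eq_norm] using hK.dist_le_mul u v
  have hzero : ∀ x : 𝔼 d, 2 ≤ ‖x‖ → unitBump d x = 0 := fun x hx =>
    (unitBump d).zero_of_le_dist (by simpa [unitBump] using hx)
  by_cases h : 2 ≤ ‖u‖ ∧ 2 ≤ ‖v‖
  · rw [hzero u h.1, hzero v h.2, sub_zero, abs_zero]
    positivity
  · have h3 : 1 + ‖u‖ ≤ 3 * (1 + ‖u - v‖) := by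
      have h0 := norm_nonneg (u - v)
      have h1 : ‖u‖ ≤ ‖u - v‖ + ‖v‖ := by simpa using norm_add_le (u - v) v
      rw [not_and_or, not_le, not_le] at h
      rcases h with h | h <;> linarith
    have h4 : 1 ≤ 3 ^ L * ((1 + ‖u - v‖) ^ L * ((1 + ‖u‖) ^ L)⁻¹) := by
      rw [← mul_assoc, ← mul_pow, ← div_eq_mul_inv, one_le_div (by positivity)]
      gcongr
    calc |unitBump d u - unitBump d v| ≤ K * ‖u - v‖ * 1 := by rwa [mul_one]
      _ ≤ K * ‖u - v‖ * (3 ^ L * ((1 + ‖u - v‖) ^ L * ((1 + ‖u‖) ^ L)⁻¹)) := by gcongr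
      _ = _ := by ring

theorem integrable_fourierInv_of_decay {d : ℕ} {b : 𝔼 d → ℂ} {J : ℕ} (hJ : d < J)
    (hb : Integrable b) {A : ℝ≥0} (hA : ∀ x, ‖𝓕⁻ b x‖ₑ ≤ A * decayFun J 0 x) :
    Integrable (𝓕⁻ b) := by
  refine ⟨(continuous_fourierInv hb).aestronglyMeasurable, ?_⟩
  refine (lintegral_mono hA).trans_lt ?_
  rw [lintegral_const_mul _ (measurable_decayFun _ _)]
  exact ENNReal.mul_lt_top ENNReal.coe_lt_top (lintegral_decayFun_lt_top hJ)

/-- By Fourier inversion, plane waves are eigenfunctions of convolution with the kernel, with the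
values of the symbol as eigenvalues. -/
theorem symbol_eq_integral {d : ℕ} {b : 𝔼 d → ℂ} (hc : Continuous b) (hb : Integrable b)
    (hk : Integrable (𝓕⁻ b)) (w x : 𝔼 d) :
    b w * planeWave w x = ∫ y, 𝓕⁻ b (x - y) * planeWave w y := by
  have h0 : Integrable (𝓕 b) := by
    have h := hk.comp_neg
    refine h.congr (Eventually.of_forall fun y => ?_)
    simp [Real.fourierInv_eq_fourier_neg]
  have h1 : b w = 𝓕 (𝓕⁻ b) w := by rw [hc.fourier_fourierInv_eq hb h0]
  rw [h1, Real.fourier_eq', ← integral_sub_left_eq_self _ volume x, ← integral_mul_const]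
  refine integral_congr_ae (Eventually.of_forall fun y => ?_)
  simp only [smul_eq_mul, planeWave]
  rw [mul_right_comm, ← Complex.exp_add, mul_comm, ← add_mul, ← Complex.ofReal_add]
  congr 4
  rw [inner_sub_left]
  ring

/-- The plane wave being an exact eigenfunction, the error comes only from the variation of the
cutoff over the range of the kernel, which at scale 2^N is of relative size 2^{-N}. -/
theorem exists_sub_fourierMultiplier_wavePacket_le {d L : ℕ} (hL : d + 1 < L) {b : 𝔼 d → ℂ}
    (hc : Continuous b) (hb : Integrable b) {A : ℝ≥0}
    (hA : ∀ x, ‖𝓕⁻ b x‖ₑ ≤ A * decayFun (2 * L) 0 x) (w : 𝔼 d) :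
    ∃ C : ℝ≥0, ∀ (N : ℕ) (x : 𝔼 d),
      ‖b w * wavePacket w N x - fourierMultiplier b (wavePacket w N) x‖ₑ ≤
        C * ENNReal.ofReal (2 ^ N)⁻¹ * decayFun L N x := by
  obtain ⟨K, hK0, hK⟩ := exists_unitBump_sub_le d L
  have hk := integrable_fourierInv_of_decay (by omega) hb hA
  have hI : ∫⁻ y, (decayFun (L - 1) 0 y : ℝ≥0∞) ∂(volume : Measure (𝔼 d)) ≠ ∞ :=
    (lintegral_decayFun_lt_top (by omega)).ne
  lift (∫⁻ y, (decayFun (L - 1) 0 y : ℝ≥0∞) ∂(volume : Measure (𝔼 d))) to ℝ≥0 using hI with I hIeq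
  refine ⟨A * K.toNNReal * I, fun N x => ?_⟩
  set ε : ℝ := (2 ^ N)⁻¹ with hε
  have hε0 : 0 < ε := by positivity
  have hε1 : ε ≤ 1 := inv_le_one_of_one_le₀ (one_le_pow₀ one_le_two)
  have hkx : Integrable fun y => 𝓕⁻ b (x - y) := hk.comp_sub_left x
  have hwc : Continuous (planeWave w) := by unfold planeWave; fun_prop
  have hint1 : Integrable fun y => 𝓕⁻ b (x - y) * planeWave w y :=
    hkx.mul_bdd (c := 1) hwc.aestronglyMeasurable
      (Eventually.of_forall fun y => (norm_planeWave w y).le)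
  have hint2 : Integrable fun y => 𝓕⁻ b (x - y) * wavePacket w N y := by
    refine hkx.mul_bdd (c := 1) (wavePacket w N).continuous.aestronglyMeasurable
      (Eventually.of_forall fun y => ?_)
    rw [wavePacket_apply, norm_mul, norm_planeWave, mul_one, Complex.norm_real,
      Real.norm_of_nonneg (unitBump d).nonneg]
    exact (unitBump d).le_one
  have hrep : b w * wavePacket w N x - fourierMultiplier b (wavePacket w N) x =
      ∫ y, 𝓕⁻ b (x - y) * planeWave w y *
        ((unitBump d (ε • x) - unitBump d (ε • y) : ℝ) : ℂ) := by
    rw [fourierMultiplier_eq_convolution hb (wavePacket w N).integrable x, wavePacket_apply,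
      mul_left_comm, symbol_eq_integral hc hb hk, ← integral_const_mul,
      ← integral_sub (hint1.const_mul _) hint2]
    refine integral_congr_ae (Eventually.of_forall fun y => ?_)
    simp only [wavePacket_apply]
    push_cast
    ring
  have hpt : ∀ y, ‖𝓕⁻ b (x - y) * planeWave w y *
      ((unitBump d (ε • x) - unitBump d (ε • y) : ℝ) : ℂ)‖ₑ ≤
      (A * K.toNNReal * ENNReal.ofReal ε * decayFun L N x) * decayFun (L - 1) 0 (x - y) := by
    intro y
    have h1 : ‖planeWave w y‖ₑ = 1 := by rw [← ofReal_norm, norm_planeWave, ENNReal.ofReal_one]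
    have h2 : ‖((unitBump d (ε • x) - unitBump d (ε • y) : ℝ) : ℂ)‖ₑ ≤
        ENNReal.ofReal (K * ε * (1 + ‖x - y‖) ^ (L + 1) * ((1 + ε * ‖x‖) ^ L)⁻¹) := by
      rw [← ofReal_norm, Complex.norm_real, Real.norm_eq_abs]
      refine ENNReal.ofReal_le_ofReal ((hK _ _).trans ?_)
      rw [← smul_sub, norm_smul, norm_smul, Real.norm_of_nonneg hε0.le]
      have h3 : ε * ‖x - y‖ ≤ ‖x - y‖ := mul_le_of_le_one_left (norm_nonneg _) hε1
      calc K * (ε * ‖x - y‖) * ((1 + ε * ‖x - y‖) ^ L * ((1 + ε * ‖x‖) ^ L)⁻¹)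
          ≤ K * (ε * (1 + ‖x - y‖)) * ((1 + ‖x - y‖) ^ L * ((1 + ε * ‖x‖) ^ L)⁻¹) := by
            gcongr
            linarith
        _ = _ := by ring
    -- Of the 2L powers of decay, L + 1 pay for the variation of the cutoff; the other L - 1 > d
    -- leave an integrable kernel.
    have h4 : ENNReal.ofReal (K * ε * (1 + ‖x - y‖) ^ (L + 1) * ((1 + ε * ‖x‖) ^ L)⁻¹) *
        decayFun (2 * L) 0 (x - y) =
        K.toNNReal * ENNReal.ofReal ε * decayFun L N x * decayFun (L - 1) 0 (x - y) := by
      rw [← ENNReal.ofReal, decayFun, decayFun, decayFun, ← hε, ← ENNReal.ofReal_mul (by positivity),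
        ← ENNReal.ofReal_mul (by positivity), ← ENNReal.ofReal_mul (by positivity),
        ← ENNReal.ofReal_mul (by positivity)]
      congr 1
      simp only [pow_zero, inv_one, one_mul]
      have h5 : (1 + ‖x - y‖) ^ (2 * L) = (1 + ‖x - y‖) ^ (L + 1) * (1 + ‖x - y‖) ^ (L - 1) := by
        rw [← pow_add]; congr 1; omega
      rw [h5]
      have h6 : (0 : ℝ) < 1 + ‖x - y‖ := by positivity
      field_simp
    rw [enorm_mul, enorm_mul, h1, mul_one]
    calc ‖𝓕⁻ b (x - y)‖ₑ * ‖((unitBump d (ε • x) - unitBump d (ε • y) : ℝ) : ℂ)‖ₑ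
        ≤ (A * decayFun (2 * L) 0 (x - y)) *
          ENNReal.ofReal (K * ε * (1 + ‖x - y‖) ^ (L + 1) * ((1 + ε * ‖x‖) ^ L)⁻¹) := by
          gcongr
          exact hA _
      _ = A * (ENNReal.ofReal (K * ε * (1 + ‖x - y‖) ^ (L + 1) * ((1 + ε * ‖x‖) ^ L)⁻¹) *
          decayFun (2 * L) 0 (x - y)) := by ring
      _ = _ := by rw [h4]; ring
  rw [hrep]
  calc ‖∫ y, 𝓕⁻ b (x - y) * planeWave w y *
        ((unitBump d (ε • x) - unitBump d (ε • y) : ℝ) : ℂ)‖ₑ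
      ≤ ∫⁻ y, (A * K.toNNReal * ENNReal.ofReal ε * decayFun L N x) *
          decayFun (L - 1) 0 (x - y) :=
        (enorm_integral_le_lintegral_enorm _).trans (lintegral_mono hpt)
    _ = (A * K.toNNReal * ENNReal.ofReal ε * decayFun L N x) * I := by
        have hm : Measurable fun y : 𝔼 d => (decayFun (L - 1) 0 (x - y) : ℝ≥0∞) :=
          (measurable_decayFun _ _).comp (measurable_const.sub measurable_id)
        rw [lintegral_const_mul _ hm, lintegral_sub_left_eq_self (fun y : 𝔼 d => decayFun (L - 1) 0 y), ← hIeq]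
    _ = _ := by push_cast; ring

/-- The single shell N + 1, where the packet has modulus 1, already gives the growth 2^{(N+1)(α +
d/p)} that bounds the norm of the decay function at the same scale. -/
theorem le_herzENorm_wavePacket {d : ℕ} (hd : 1 ≤ d) {α p q : ℝ} (hp : 1 ≤ p) (hq : 1 ≤ q)
    (w : 𝔼 d) (N : ℕ) :
    ENNReal.ofReal ((ballVolume d / 2) ^ (1 / p) * 2 ^ ((N + 1 : ℕ) * (α + d / p))) ≤
      herzENorm α p q (wavePacket w (N + 1)) := by
  have hbv := ballVolume_pos d
  refine le_trans ?_ (herzLNorm_le_herzENorm hp hq _)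
  refine le_trans ?_ (le_seqNorm hq _ (N + 1))
  have hone : ∀ x ∈ herzShell d (N + 1), ‖wavePacket w (N + 1) x‖ₑ = 1 := fun x hx => by
    have h1 : ‖((2 : ℝ) ^ (N + 1))⁻¹ • x‖ ≤ 1 := by
      rw [norm_smul, Real.norm_of_nonneg (by positivity), inv_mul_le_one₀ (by positivity)]
      exact norm_le_of_mem_herzShell hx
    rw [← ofReal_norm, wavePacket_apply, norm_mul, norm_planeWave,
      (unitBump d).one_of_mem_closedBall (by simpa [unitBump] using h1)]
    simp
  have hint : ∫⁻ x in herzShell d (N + 1), ‖wavePacket w (N + 1) x‖ₑ ^ p =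
      volume (herzShell d (N + 1)) := by
    rw [setLIntegral_congr_fun (measurableSet_herzShell d _) (g := fun _ => 1) fun x hx => by
      simp only [hone x hx, ENNReal.one_rpow]]
    simp
  rw [herzShellNorm, hint]
  calc _ = ENNReal.ofReal (2 ^ ((N + 1 : ℕ) * α)) *
        ENNReal.ofReal (ballVolume d * 2 ^ ((N + 1) * d) / 2) ^ (1 / p) := by
        rw [ENNReal.ofReal_rpow_of_nonneg (by positivity) (by positivity),
          ← ENNReal.ofReal_mul (by positivity)]
        congr 1
        rw [mul_div_right_comm, Real.mul_rpow (by positivity) (by positivity),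
          ← Real.rpow_natCast 2 ((N + 1) * d), ← Real.rpow_mul zero_le_two, mul_left_comm,
          ← Real.rpow_add two_pos]
        congr 2
        push_cast
        ring
    _ ≤ _ := by
        gcongr
        exact le_volume_herzShell_succ hd N

theorem exists_rescaledSymbol_eq {d : ℕ} (hd : 1 ≤ d) {δ t : ℝ} (hδ : 0 < δ) (h0 : 0 ≤ t)
    (h1 : t ≤ 1) : ∃ w : 𝔼 d, rescaledSymbol δ w = t := by
  have : Nonempty (Fin d) := ⟨⟨0, hd⟩⟩
  obtain ⟨v, hv⟩ := exists_norm_eq (𝔼 d) (Real.sqrt_nonneg (1 - t ^ (1 / δ)))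
  refine ⟨(2 * Real.pi)⁻¹ • v, ?_⟩
  have h2 : t ^ (1 / δ) ≤ 1 := Real.rpow_le_one h0 h1 (by positivity)
  rw [rescaledSymbol, smul_inv_smul₀ (by positivity), bochnerRieszSymbol, hv,
    Real.sq_sqrt (by linarith), sub_sub_cancel, max_eq_left (by positivity), ← Real.rpow_mul h0,
    one_div_mul_cancel hδ.ne', Real.rpow_one]

/-! ### The unit interval is contained in the spectrum -/

namespace HerzSpace

variable {d : ℕ} {α p q : ℝ} [hp : Fact (1 ≤ p)] [hq : Fact (1 ≤ q)]

/-- The values of a symbol with rapidly decaying kernel belong to the spectrum. -/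
theorem symbol_mem_spectrum (hd : 1 ≤ d) (hα : -(d : ℝ) / p < α) {b : 𝔼 d → ℂ}
    (hc : Continuous b) (hb : Integrable b) {A : ℝ≥0}
    (hA : ∀ x, ‖𝓕⁻ b x‖ₑ ≤ A * decayFun (2 * herzDecay d α) 0 x)
    {T : HerzSpace d α p q →L[ℂ] HerzSpace d α p q}
    (hT : ∀ f : 𝓢(𝔼 d, ℂ), (T (ofSchwartz hα f)).fn =ᵐ[volume] fourierMultiplier b f) (w : 𝔼 d) :
    b w ∈ spectrum ℂ T := by
  intro hu
  obtain ⟨u, hu⟩ := hu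
  obtain ⟨C₁, hC₁⟩ := exists_sub_fourierMultiplier_wavePacket_le
    (by rw [herzDecay]; omega) hc hb hA w
  obtain ⟨C₂, hC₂⟩ := exists_herzLNorm_decayFun_le (d := d) hp.out hq.out hα
  set R : HerzSpace d α p q →L[ℂ] HerzSpace d α p q := ↑u⁻¹ with hR
  set c : ℝ := (ballVolume d / 2) ^ (1 / p) with hcdef
  have hc0 : 0 < c := by
    have := ballVolume_pos d
    positivity
  -- If R inverts b(w) - T, then F = R G for the packet F and its error G. The common scale r
  -- cancels from ‖F‖ ≤ ‖R‖ ‖G‖ and leaves a factor 2^{-(N+1)}, impossible as N → ∞ because c > 0.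
  have hmain : ∀ N : ℕ, c ≤ ‖R‖ * (2 * (C₁ * C₂)) * (2 ^ (N + 1))⁻¹ := by
    intro N
    set F : HerzSpace d α p q := ofSchwartz hα (wavePacket w (N + 1)) with hF
    set G : HerzSpace d α p q := b w • F - T F with hG
    set r : ℝ := 2 ^ ((N + 1 : ℕ) * (α + d / p)) with hr
    have hr0 : 0 < r := by positivity
    have hRG : R G = F := by
      have h1 : (u : HerzSpace d α p q →L[ℂ] HerzSpace d α p q) F = G := by
        rw [hu, hG]
        simp [Algebra.algebraMap_eq_smul_one]
      have h2 : R * u = 1 := u.inv_mul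
      rw [← h1]
      exact congrArg (fun S : HerzSpace d α p q →L[ℂ] HerzSpace d α p q => S F) h2
    have hlow : c * r ≤ ‖F‖ := by
      have h := le_herzENorm_wavePacket hd (α := α) hp.out hq.out w N
      rw [← enorm_eq_of_ae (coeFn_ofSchwartz (q := q) hα (wavePacket w (N + 1))),
        ← ofReal_norm] at h
      exact (ENNReal.ofReal_le_ofReal_iff (norm_nonneg _)).mp h
    have hup : ‖G‖ ≤ 2 * (C₁ * C₂) * (2 ^ (N + 1))⁻¹ * r := by
      have hae : G.fn =ᵐ[volume] fun x => b w * wavePacket w (N + 1) x -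
          fourierMultiplier b (wavePacket w (N + 1)) x := by
        filter_upwards [coeFn_sub (b w • F) (T F), coeFn_smul (b w) F,
          coeFn_ofSchwartz (q := q) hα (wavePacket w (N + 1)), hT (wavePacket w (N + 1))]
          with x h1 h2 h3 h4
        rw [h1, h2, h3, h4]
      have h : ‖G‖ₑ ≤ ENNReal.ofReal (2 * (C₁ * C₂) * (2 ^ (N + 1))⁻¹ * r) := by
        rw [enorm_eq_of_ae hae]
        refine (herzENorm_le_two_mul hp.out hq.out _).trans ?_
        calc _ ≤ 2 * (C₁ * ENNReal.ofReal (2 ^ (N + 1))⁻¹ * (C₂ * ENNReal.ofReal r)) := by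
              gcongr
              refine (herzLNorm_mono hp.out hq.out (hC₁ (N + 1))).trans ?_
              rw [herzLNorm_const_mul hp.out hq.out (measurable_decayFun _ _)]
              gcongr
              exact hC₂ (N + 1)
          _ = _ := by
              rw [ENNReal.ofReal_mul (by positivity), ENNReal.ofReal_mul (by positivity),
                ENNReal.ofReal_mul (by positivity), ENNReal.ofReal_mul (by positivity),
                ENNReal.ofReal_coe_nnreal, ENNReal.ofReal_coe_nnreal, ENNReal.ofReal_ofNat]
              ring
      rw [← ofReal_norm] at h
      exact (ENNReal.ofReal_le_ofReal_iff (by positivity)).mp h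
    have h1 : c * r ≤ ‖R‖ * (2 * (C₁ * C₂)) * (2 ^ (N + 1))⁻¹ * r := by
      calc c * r ≤ ‖F‖ := hlow
        _ = ‖R G‖ := by rw [hRG]
        _ ≤ ‖R‖ * ‖G‖ := R.le_opNorm G
        _ ≤ ‖R‖ * (2 * (C₁ * C₂) * (2 ^ (N + 1))⁻¹ * r) := by gcongr
        _ = _ := by ring
    exact le_of_mul_le_mul_right h1 hr0
  have hlim : Tendsto (fun N : ℕ => ‖R‖ * (2 * (C₁ * C₂)) * ((2 : ℝ) ^ (N + 1))⁻¹) atTop (𝓝 0) := by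
    have h := (tendsto_inv_atTop_zero.comp (tendsto_pow_atTop_atTop_of_one_lt
      (one_lt_two (α := ℝ)))).comp (tendsto_add_atTop_nat 1)
    simpa using h.const_mul (‖R‖ * (2 * (C₁ * C₂)))
  exact absurd (ge_of_tendsto' hlim hmain) (not_le.mpr hc0)

/-- T itself may lack a decaying kernel, so approximate eigenfunctions are applied to T^n, and
spectral mapping for powers brings the conclusion back to T. -/
theorem unitSegment_subset_spectrum (hd : 1 ≤ d) (hα : -(d : ℝ) / p < α) {δ : ℝ} (hδ : 0 < δ)
    {T : HerzSpace d α p q →L[ℂ] HerzSpace d α p q}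
    (hT : Agrees T (l2Multiplier _ (memLp_rescaledSymbol hδ))) : unitSegment ⊆ spectrum ℂ T := by
  rintro _ ⟨t, ht0, ht1, rfl⟩
  obtain ⟨n, hn⟩ := exists_nat_gt (((2 * herzDecay d α : ℕ) : ℝ) / δ)
  rw [div_lt_iff₀' hδ] at hn
  have hn0 : n ≠ 0 := by
    rintro rfl
    simp only [Nat.cast_zero, mul_zero] at hn
    exact absurd hn (not_lt.mpr (Nat.cast_nonneg _))
  -- Any point off the segment would do: the exponent j is 0 below, so z does not enter the symbol.
  have hz := neg_one_notMem_unitSegment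
  have hTn := hT.pow n
  rw [← l2Multiplier_rescaledSymbol_pow hδ hn0 hz] at hTn
  have hs := hasCompactSupport_resolventSymbol (d := d) hδ hn0 (-1) 0
  have hcont := continuous_resolventSymbol (d := d) hδ n hz 0
  obtain ⟨A, hA⟩ := exists_fourierInv_decay (contDiff_resolventSymbol (d := d) hδ hn hz 0) hs
  obtain ⟨w, hw⟩ := exists_rescaledSymbol_eq hd hδ ht0 ht1
  have h := symbol_mem_spectrum hd hα hcont (hcont.integrable_of_hasCompactSupport hs) hA
    (hTn.ae_eq_schwartz hα) w
  rw [spectrum.map_pow_of_pos T (Nat.pos_of_ne_zero hn0)] at h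
  obtain ⟨μ, hμ, hμn⟩ := h
  -- The inclusion already proved makes the n-th root a nonnegative real, which singles out t among
  -- the roots of t^n.
  obtain ⟨s, hs0, -, rfl⟩ := spectrum_subset_unitSegment hα hδ hT hμ
  have hst : s ^ n = t ^ n := by
    simp only [resolventSymbol, pow_zero, mul_one, hw] at hμn
    exact_mod_cast hμn
  rwa [(pow_left_inj₀ hs0 ht0 hn0).mp hst] at hμ

end HerzSpace

theorem mainTheorem9 (d : ℕ) (hd : 1 ≤ d) (δ α p q : ℝ) (hδ : 0 < δ)
    [Fact (1 ≤ p)] [Fact (1 ≤ q)] (hα : -(d : ℝ) / p < α)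
    (hB : BochnerRieszBoundedOnHerz d δ α p q) :
    ∃ T : HerzSpace d α p q →L[ℂ] HerzSpace d α p q,
      ExtendsBochnerRiesz δ T ∧
      (∀ T' : HerzSpace d α p q →L[ℂ] HerzSpace d α p q, ExtendsBochnerRiesz δ T' → T' = T) ∧
      spectrum ℂ T = {z : ℂ | ∃ t : ℝ, 0 ≤ t ∧ t ≤ 1 ∧ z = (t : ℂ)} := by
  obtain ⟨C, hC⟩ := hB
  simp only [bochnerRiesz_eq_fourierMultiplier] at hC
  obtain ⟨T, hT1, hT2⟩ :=
    HerzSpace.exists_multiplier_extension hα (HerzSpace.memLp_rescaledSymbol hδ) hC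
  refine ⟨T, fun f F hF => ?_, fun T' hT' => ?_, ?_⟩
  · have h : F = HerzSpace.ofSchwartz hα f :=
      HerzSpace.ext_ae (EventuallyEq.trans hF (HerzSpace.coeFn_ofSchwartz hα f).symm)
    rw [h, bochnerRiesz_eq_fourierMultiplier]
    exact hT1 f
  · refine DFunLike.coe_injective ((HerzSpace.denseRange_ofSchwartz hα).equalizer
      T'.continuous T.continuous ?_)
    ext1 f
    have h := hT' f _ (HerzSpace.coeFn_ofSchwartz hα f)
    rw [bochnerRiesz_eq_fourierMultiplier] at h
    exact HerzSpace.ext_ae (EventuallyEq.trans h (hT1 f).symm)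
  · exact Set.Subset.antisymm (HerzSpace.spectrum_subset_unitSegment hα hδ hT2)
      (HerzSpace.unitSegment_subset_spectrum hd hα hδ hT2)
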